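/- A (rooted planar) map is a cellular embedding of a connected planar graph (loops and multiple edges allowed) into the oriented sphere, considered up to orientation-preserving homeomorphism, together with a root: an additional half-edge pointing on a vertex (the root-vertex) from one of its corners, which does not count as an edge. A (plane) tree is a rooted map with a single face. A tree-rooted map $M_T$ is a rooted map $M$ together with a distinguished spanning tree $T$ of $M$, which inherits the root. The size of a map, a tree or a tree-rooted map is its number of edges. The tour of a tree means following its border in counterclockwise direction (with the tree on the left), starting and finishing at the root; it orders the vertices of a tree by their first appearance, and the tour of a spanning tree $T$ of $M$ orders the half-edges of $M$ that are not in $T$. A non-crossing partition of size $m$ is an equivalence relation $\sim$ on $\{1,\dots,m\}$ such that no $a<b<c<d$ satisfy $a\sim c$, $b\sim d$ and $a\not\sim b$. Let $M_T$ be a tree-rooted map of size $n$. Orient its edges as follows: the edges of $T$ are oriented from the root to the leaves, and each edge not in $T$ is oriented so that its head (the half-edge at its end) precedes its tail (the half-edge at its origin) around $T$, i.e. is met first in the tour of $T$. The root is considered as a head. Then replace each vertex $v$ by as many vertices as there are heads incident to $v$, each tail $t$ at $v$ remaining adjacent to exactly one head, namely the first head encountered in counterclockwise direction around $v$ starting from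 $t$; the cyclic orders of half-edges around the new vertices are inherited from those of $M$. Let $\varphi_0$ be the resulting object, with the same root, and let $\varphi_1$ be the equivalence relation on its vertices, numbered $1,2,\dots$ by their order of appearance around $\varphi_0$, for which two vertices are equivalent if they come from the same vertex of $M$. Theorem. Let $n\ge 0$. For every tree-rooted map $M_T$ of size $n$, $\varphi_0$ is a plane tree of size $n$ (hence has $n+1$ vertices) and $\varphi_1$ is a non-crossing partition of size $n+1$. The mapping $\Phi: M_T\mapsto(\varphi_0,\varphi_1)$ is a bijection from the set of tree-rooted maps of size $n$ onto the Cartesian product of the set of plane trees of size $n$ and the set of non-crossing partitions of size $n+1$. Consequently the number of tree-rooted maps of size $n$ is $\mathrm{Cat}(n)\,\mathrm{Cat}(n+1)$, where $\mathrm{Cat}(n)=\frac{1}{n+1}\binom{2n}{n}$. -/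

import Mathlib

/-!
Rooted planar maps, considered up to orientation-preserving homeomorphism, are represented in the
standard way by their rotation systems: a finite set `H` of half-edges, the permutation `rot` that
sends a half-edge to the next one in counterclockwise direction around its vertex, and the
involution `edge` that exchanges the two halves of every edge. The root is an additional half-edge
(an arrow pointing on the root-vertex), which is not a part of an edge: it is the unique fixed
point of `edge`. Vertices are the cycles of `rot`.
-/

theorem firstReturn_exists {H ι : Type*} [Finite H] (f : Equiv.Perm H) (p : H → ι) (x : H) :
    ∃ k : ℕ, 0 < k ∧ p (f^[k] x) = p x := by
  refine ⟨orderOf f, orderOf_pos f, ?_⟩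
  rw [← Equiv.Perm.coe_pow, pow_orderOf_eq_one]
  rfl

open Classical in
/-- The least `k > 0` for which the `k`-th iterate of `f` brings `x` back to its class. -/
noncomputable def firstReturnTime {H ι : Type*} [Finite H] (f : Equiv.Perm H) (p : H → ι)
    (x : H) : ℕ :=
  Nat.find (firstReturn_exists f p x)

open Classical in
theorem firstReturnTime_spec {H ι : Type*} [Finite H] (f : Equiv.Perm H) (p : H → ι) (x : H) :
    0 < firstReturnTime f p x ∧ p (f^[firstReturnTime f p x] x) = p x :=
  Nat.find_spec (firstReturn_exists f p x)

open Classical in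
theorem firstReturnTime_le {H ι : Type*} [Finite H] (f : Equiv.Perm H) (p : H → ι) (x : H)
    {k : ℕ} (hk : 0 < k) (h : p (f^[k] x) = p x) : firstReturnTime f p x ≤ k :=
  Nat.find_min' (firstReturn_exists f p x) ⟨hk, h⟩

theorem firstReturn_aux {H ι : Type*} [Finite H] (f : Equiv.Perm H) (p : H → ι) {x y : H}
    (hle : firstReturnTime f p x ≤ firstReturnTime f p y)
    (h : f^[firstReturnTime f p x] x = f^[firstReturnTime f p y] y) : x = y := by
  obtain ⟨hx0, hx⟩ := firstReturnTime_spec f p x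
  obtain ⟨hy0, hy⟩ := firstReturnTime_spec f p y
  obtain ⟨d, hd⟩ := Nat.exists_eq_add_of_le hle
  have h1 : x = f^[d] y := by
    rw [hd, Function.iterate_add_apply] at h
    exact (f.injective.iterate _) h
  rcases Nat.eq_zero_or_pos d with rfl | hpos
  · simpa using h1
  · have h2 : p (f^[d] y) = p y := by rw [← h1, ← hx, h, hy]
    have := firstReturnTime_le f p y hpos h2
    omega

theorem firstReturn_injective {H ι : Type*} [Finite H] (f : Equiv.Perm H) (p : H → ι) :
    Function.Injective fun x => f^[firstReturnTime f p x] x := by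
  intro x y h
  rcases le_total (firstReturnTime f p x) (firstReturnTime f p y) with hle | hle
  · exact firstReturn_aux f p hle h
  · exact (firstReturn_aux f p hle h.symm).symm

/-- First return of the permutation `f` to the classes `{y | p y = p x}`: the point `x` is sent to
the first of `f x, f (f x), …` in the same class as `x`. In words, every class inherits the cyclic
orders of `f`, the other elements being skipped. -/
noncomputable def firstReturn {H ι : Type*} [Finite H] (f : Equiv.Perm H) (p : H → ι) :
    Equiv.Perm H :=
  Equiv.ofBijective (fun x => f^[firstReturnTime f p x] x)
    (Finite.injective_iff_bijective.mp (firstReturn_injective f p))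

theorem firstReturn_class {H ι : Type*} [Finite H] (f : Equiv.Perm H) (p : H → ι) (x : H) :
    p (firstReturn f p x) = p x :=
  (firstReturnTime_spec f p x).2

/-- The raw data of a rooted map with set of half-edges `H`. -/
structure MapData (H : Type*) where
  /-- the next half-edge in counterclockwise direction around the same vertex -/
  rot : Equiv.Perm H
  /-- the other half of the same edge (the root is fixed) -/
  edge : Equiv.Perm H
  /-- the root -/
  root : H

namespace MapData

variable {H : Type*}

/-- `x` and `y` are incident to the same vertex. -/
def SameVertex (M : MapData H) (x y : H) : Prop := M.rot.SameCycle x y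

/-- The number of vertices. -/
noncomputable def numVertices (M : MapData H) : ℕ :=
  Nat.card (Quotient (Equiv.Perm.SameCycle.setoid M.rot))

/-- The number of edges: the cycles of `edge`, except for the fixed point formed by the root. -/
noncomputable def numEdges (M : MapData H) : ℕ :=
  Nat.card {q : Quotient (Equiv.Perm.SameCycle.setoid M.edge) //
    q ≠ Quotient.mk (Equiv.Perm.SameCycle.setoid M.edge) M.root}

/-- The number of faces. -/
noncomputable def numFaces (M : MapData H) : ℕ :=
  Nat.card (Quotient (Equiv.Perm.SameCycle.setoid (M.rot * M.edge)))

/-- The vertices incident to `x` and `y` are joined by a path whose edges have their half-edges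
in `S`. -/
def Joined (M : MapData H) (S : Set H) : H → H → Prop :=
  Relation.EqvGen fun x y => y = M.rot x ∨ (x ∈ S ∧ y = M.edge x)

/-- Rooted planar maps: connected, and of genus `0` by Euler's formula. -/
structure IsRootedMap (M : MapData H) : Prop where
  edge_edge : ∀ x, M.edge (M.edge x) = x
  edge_eq_self_iff : ∀ x, M.edge x = x ↔ x = M.root
  connected : ∀ x y, M.Joined Set.univ x y
  euler : M.numVertices + M.numFaces = M.numEdges + 2

/-- Planted plane trees: rooted planar maps with a single face. -/
def IsPlaneTree (M : MapData H) : Prop := M.IsRootedMap ∧ M.numFaces = 1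

/-- The submap with set of half-edges `T` (which contains the root and both or none of the halves
of an edge). -/
noncomputable def submap [Finite H] (M : MapData H) (T : Set H) (hroot : M.root ∈ T)
    (hedge : ∀ x, M.edge x ∈ T ↔ x ∈ T) : MapData T where
  rot := (firstReturn M.rot fun x => x ∈ T).subtypePerm
    fun x => iff_of_eq (firstReturn_class M.rot (fun x => x ∈ T) x)
  edge := M.edge.subtypePerm hedge
  root := ⟨M.root, hroot⟩

/-- `T` is the set of half-edges (including the root) of a spanning tree of `M`: a submap that is
a tree and contains every vertex. -/
def IsSpanningTree [Finite H] (M : MapData H) (T : Set H) : Prop :=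
  (∃ (hroot : M.root ∈ T) (hedge : ∀ x, M.edge x ∈ T ↔ x ∈ T),
    (M.submap T hroot hedge).IsPlaneTree) ∧
  ∀ x, ∃ y ∈ T, M.SameVertex x y

open Classical in
/-- One step of the tour of `T`, in counterclockwise direction around `T` (that is, with `T` on the
left): when the half-edge `x` is met, we follow the border of its edge if `x` is in `T`, and cross
`x` otherwise; in both cases we proceed to the next half-edge around the vertex where we are. -/
noncomputable def tourStep (M : MapData H) (T : Set H) (x : H) : H :=
  if x ∈ T then M.rot (M.edge x) else M.rot x

/-- The half-edge met at time `k` of the tour of `T`, which starts at the root. -/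
noncomputable def tour (M : MapData H) (T : Set H) (k : ℕ) : H := (M.tourStep T)^[k] M.root

/-- The half-edge `x` precedes the half-edge `y` around `T`. -/
def Precedes (M : MapData H) (T : Set H) (x y : H) : Prop :=
  ∃ k, M.tour T k = x ∧ ∀ j ≤ k, M.tour T j ≠ y

/-- The orientation of `M` given by the spanning tree `T`, as the set of heads.
* The root is a head.
* The edges in `T` are oriented from the root to the leaves: a half-edge of `T` is a head if it lies
  on the side away from the root when its edge is removed from `T`.
* An edge not in `T` is oriented so that its head precedes its tail around `T`. -/
def treeHeads (M : MapData H) (T : Set H) : Set H :=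
  {x | x = M.root ∨
    (x ∈ T ∧ ¬ M.Joined (T \ {x, M.edge x}) M.root x) ∨
    (x ∉ T ∧ M.Precedes T x (M.edge x))}

open Classical in
/-- The first head encountered in counterclockwise direction around the vertex of `x`, starting
from `x` (a head is sent to itself). Here `O` is the set of heads. -/
noncomputable def firstHead (M : MapData H) (O : Set H) (x : H) : H :=
  if h : ∃ k : ℕ, M.rot^[k] x ∈ O then M.rot^[Nat.find h] x else x

/-- The map produced by the vertex explosion process from the orientation of `M` with set of heads
`O`: every vertex is replaced by as many vertices as incident heads, each tail being kept
adjacent only to the first head encountered in counterclockwise direction. The cyclic order around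
the new vertices is inherited from `M`. -/
noncomputable def explosion [Finite H] (M : MapData H) (O : Set H) : MapData H where
  rot := firstReturn M.rot (M.firstHead O)
  edge := M.edge
  root := M.root

/-- At time `k`, the tour of the tree `M` arrives for the first time at some vertex. -/
def IsDiscoveryTime (M : MapData H) (k : ℕ) : Prop :=
  ∀ j < k, ¬ M.SameVertex (M.tour Set.univ j) (M.tour Set.univ k)

/-- A half-edge incident to the `i`-th vertex of the tree `M` (counting from `0`), in the order of
appearance around `M`. -/
noncomputable def nthVertex (M : MapData H) (i : ℕ) : H :=
  M.tour Set.univ (Nat.nth M.IsDiscoveryTime i)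

/-- The equivalence relation on the vertices of the exploded map, numbered by their order
of appearance around that tree: two of them are equivalent if they come from the same
vertex of `M`. -/
noncomputable def explosionRel [Finite H] (M : MapData H) (O : Set H) (m : ℕ) : Setoid (Fin m) :=
  Setoid.comap (fun i : Fin m => (M.explosion O).nthVertex i)
    (Equiv.Perm.SameCycle.setoid M.rot)

/-- `e` is an isomorphism of rooted maps. -/
structure IsIso {H' : Type*} (M : MapData H) (N : MapData H') (e : H ≃ H') : Prop where
  rot : ∀ x, e (M.rot x) = N.rot (e x)
  edge : ∀ x, e (M.edge x) = N.edge (e x)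
  root : e M.root = N.root

theorem IsIso.refl (M : MapData H) : M.IsIso M (Equiv.refl H) :=
  ⟨fun _ => rfl, fun _ => rfl, rfl⟩

theorem IsIso.symm {H' : Type*} {M : MapData H} {N : MapData H'} {e : H ≃ H'}
    (h : M.IsIso N e) : N.IsIso M e.symm :=
  ⟨fun x => by rw [e.symm_apply_eq, h.rot, e.apply_symm_apply],
    fun x => by rw [e.symm_apply_eq, h.edge, e.apply_symm_apply],
    by rw [e.symm_apply_eq, h.root]⟩

theorem IsIso.trans {H' H'' : Type*} {M : MapData H} {N : MapData H'} {P : MapData H''}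
    {e : H ≃ H'} {e' : H' ≃ H''} (h : M.IsIso N e) (h' : N.IsIso P e') :
    M.IsIso P (e.trans e') :=
  ⟨fun x => by simp [h.rot, h'.rot], fun x => by simp [h.edge, h'.edge],
    by simp [h.root, h'.root]⟩

end MapData

/-- Planted plane trees with `n` edges and labelled half-edges (`2 n` of them, and the root). -/
def LabelledPlaneTree (n : ℕ) : Type :=
  {M : MapData (Fin (2 * n + 1)) // M.IsPlaneTree}

/-- Isomorphism of plane trees. -/
instance LabelledPlaneTree.setoid (n : ℕ) : Setoid (LabelledPlaneTree n) where
  r M N := ∃ e, M.1.IsIso N.1 e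
  iseqv := ⟨fun M => ⟨_, .refl M.1⟩, fun ⟨_, h⟩ => ⟨_, h.symm⟩, fun ⟨_, h⟩ ⟨_, h'⟩ => ⟨_, h.trans h'⟩⟩

/-- Planted plane trees of size `n`. -/
def PlaneTree (n : ℕ) : Type := Quotient (LabelledPlaneTree.setoid n)

/-- Tree-rooted maps with `n` edges and labelled half-edges (`2 n` of them, and the root). -/
structure LabelledTreeRootedMap (n : ℕ) where
  /-- the underlying rooted map -/
  map : MapData (Fin (2 * n + 1))
  isRootedMap : map.IsRootedMap
  /-- the distinguished spanning tree -/
  tree : Set (Fin (2 * n + 1))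
  isSpanningTree : map.IsSpanningTree tree

namespace LabelledTreeRootedMap

variable {n : ℕ}

/-- The tree produced from a tree-rooted map by orienting it and exploding its vertices. -/
noncomputable def phi0 (M : LabelledTreeRootedMap n) : MapData (Fin (2 * n + 1)) :=
  M.map.explosion (M.map.treeHeads M.tree)

/-- The partition produced from a tree-rooted map by orienting it and exploding its vertices. -/
noncomputable def phi1 (M : LabelledTreeRootedMap n) : Setoid (Fin (n + 1)) :=
  M.map.explosionRel (M.map.treeHeads M.tree) (n + 1)

/-- Isomorphism of tree-rooted maps. -/
instance setoid (n : ℕ) : Setoid (LabelledTreeRootedMap n) where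
  r M N := ∃ e, M.map.IsIso N.map e ∧ ∀ x, e x ∈ N.tree ↔ x ∈ M.tree
  iseqv :=
    ⟨fun M => ⟨_, .refl M.map, fun _ => Iff.rfl⟩,
      fun ⟨e, h, ht⟩ => ⟨_, h.symm, fun x => by rw [← ht, e.apply_symm_apply]⟩,
      fun ⟨e, h, ht⟩ ⟨e', h', ht'⟩ => ⟨_, h.trans h', fun x => by
        rw [Equiv.trans_apply, ht', ht]⟩⟩

end LabelledTreeRootedMap

/-- Tree-rooted maps of size `n`. -/
def TreeRootedMap (n : ℕ) : Type := Quotient (LabelledTreeRootedMap.setoid n)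

/-- The equivalence relation `r` on a linearly ordered set is a non-crossing partition. -/
def IsNonCrossing {S : Type*} [LinearOrder S] (r : Setoid S) : Prop :=
  ∀ a b c d : S, a < b → b < c → c < d → r a c → r b d → r a b

/-- Non-crossing partitions of size `m`. -/
def NonCrossingPartition (m : ℕ) : Type := {r : Setoid (Fin m) // IsNonCrossing r}

/-!
With `α` exchanging the two halves of every edge of a set `T`, and fixing the other half-edges, the
tour of `T` is the permutation `rot * α`. The set `T` is a spanning tree if and only if this
permutation has a single cycle around which `α` is a non-crossing matching. This is an instance of
Biane's criterion: for a single cycle `τ`, the cycles of `β` are non-crossing around `τ` if and only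
if `β` and `τ * β` have `card + 1` cycles in total, which counts the dimensions of the spaces of
functions invariant under `β` and under `τ * β`.

When the half-edges are ranked along the tour, the root being last, the rank increases from each
head other than the root to the head that its edge points back to in the exploded map. All the
vertices of the exploded map are thus connected to the root, and it is a tree since it has one
vertex more than it has edges. The permutation that merges these vertices into those of the map
acts on the heads only. By Euler's formula it satisfies Biane's criterion around the tour of the
exploded map, so `φ₁` is non-crossing. Conversely, the heads of the map are those of the exploded
map, and a non-crossing factor is determined by its cycles, so `Φ` is injective.

For surjectivity it is enough to count. A shuffle of two non-crossing matchings, for the edges in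
and outside the spanning tree, is the tour of a tree-rooted map, which yields at least
`Cat n * Cat (n + 1)` of them. The plane trees and the non-crossing partitions are at most
`Cat n` and `Cat (n + 1)` in number, by the Catalan recurrence.
-/

open Equiv.Perm

section Cycles

variable {H : Type*}

theorem sameCycle_iff_exists_iterate [Finite H] {f : Equiv.Perm H} {x y : H} :
    f.SameCycle x y ↔ ∃ k : ℕ, f^[k] x = y := by
  constructor
  · intro h
    obtain ⟨k, hk⟩ := h.exists_nat_pow_eq
    exact ⟨k, by rwa [← Equiv.Perm.coe_pow]⟩
  · rintro ⟨k, rfl⟩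
    exact ⟨k, by rw [zpow_natCast, Equiv.Perm.coe_pow]⟩

theorem mem_iff_of_sameCycle [Finite H] {f : Equiv.Perm H} {s : Set H}
    (hs : ∀ x ∈ s, f x ∈ s) {x y : H} (h : f.SameCycle x y) : x ∈ s ↔ y ∈ s := by
  have mapsTo {x y : H} (h : f.SameCycle x y) (hx : x ∈ s) : y ∈ s := by
    obtain ⟨k, rfl⟩ := sameCycle_iff_exists_iterate.1 h
    exact Set.MapsTo.iterate (f := f) hs k hx
  exact ⟨mapsTo h, mapsTo h.symm⟩

/-- The number of cycles of a permutation, fixed points included. -/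
noncomputable def numCycles (f : Equiv.Perm H) : ℕ :=
  Nat.card (Quotient (Equiv.Perm.SameCycle.setoid f))

theorem numCycles_eq_one_iff [Nonempty H] {f : Equiv.Perm H} :
    numCycles f = 1 ↔ ∀ x y, f.SameCycle x y := by
  rw [numCycles, Nat.card_eq_one_iff_unique]
  constructor
  · rintro ⟨h, -⟩ x y
    exact Quotient.exact (s := Equiv.Perm.SameCycle.setoid f) (h.elim _ _)
  · intro h
    refine ⟨⟨fun a b => ?_⟩, ⟨Quotient.mk _ (Classical.arbitrary H)⟩⟩
    induction a using Quotient.inductionOn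
    induction b using Quotient.inductionOn
    exact Quotient.sound (h _ _)

theorem numCycles_eq_of_sameCycle_iff {H' : Type*} {f : Equiv.Perm H} {g : Equiv.Perm H'}
    (φ : H → H') (hφ : ∀ x y, f.SameCycle x y ↔ g.SameCycle (φ x) (φ y))
    (hsurj : ∀ y, ∃ x, g.SameCycle (φ x) y) : numCycles f = numCycles g := by
  let s : Setoid H := Equiv.Perm.SameCycle.setoid f
  let s' : Setoid H' := Equiv.Perm.SameCycle.setoid g
  let ψ : Quotient s → Quotient s' := Quotient.map φ fun x y h => (hφ x y).1 h
  refine Nat.card_congr (Equiv.ofBijective ψ ⟨?_, ?_⟩)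
  · intro a b
    induction a using Quotient.inductionOn
    induction b using Quotient.inductionOn
    exact fun h => Quotient.sound ((hφ _ _).2 (Quotient.exact h))
  · intro b
    induction b using Quotient.inductionOn with
    | _ y =>
      obtain ⟨x, hx⟩ := hsurj y
      exact ⟨Quotient.mk _ x, Quotient.sound hx⟩

theorem numCycles_conj (f g : Equiv.Perm H) : numCycles (g * f * g⁻¹) = numCycles f :=
  numCycles_eq_of_sameCycle_iff (⇑g⁻¹) (fun _ _ => sameCycle_conj)
    (fun y => ⟨g y, by simp [SameCycle.refl]⟩)

theorem sameCycle_involutive_iff [Finite H] {γ : Equiv.Perm H} (hγ : ∀ x, γ (γ x) = x) {x y : H} :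
    γ.SameCycle x y ↔ y = x ∨ y = γ x := by
  constructor
  · intro h
    have closed : ∀ z ∈ ({x, γ x} : Set H), γ z ∈ ({x, γ x} : Set H) := by
      rintro z (rfl | rfl) <;> simp [hγ]
    exact (mem_iff_of_sameCycle closed h).1 (.inl rfl)
  · rintro (rfl | rfl)
    · exact .refl _ _
    · exact sameCycle_apply_right.2 (.refl _ _)

/-- Counting every half-edge once, and every fixed point once more, each cycle is counted twice. -/
theorem two_mul_numCycles [Finite H] {γ : Equiv.Perm H} (hγ : ∀ x, γ (γ x) = x) :
    2 * numCycles γ = Nat.card H + Nat.card {x // γ x = x} := by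
  classical
  have := Fintype.ofFinite H
  let s : Setoid H := Equiv.Perm.SameCycle.setoid γ
  have fiber (q : Quotient s) :
      ∑ x with (Quotient.mk s x = q), (1 + if γ x = x then 1 else 0) = 2 := by
    induction q using Quotient.inductionOn with
    | _ a =>
      have hfiber : ({x | Quotient.mk s x = Quotient.mk s a} : Finset H) = {a, γ a} := by
        ext x
        simp only [Finset.mem_filter_univ, Finset.mem_insert, Finset.mem_singleton]
        rw [Quotient.eq]
        exact sameCycle_comm.trans (sameCycle_involutive_iff hγ)
      rw [hfiber]
      by_cases ha : γ a = a
      · simp [ha]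
      · rw [Finset.sum_pair (Ne.symm ha)]
        simp [hγ, ha, Ne.symm ha]
  have total := Finset.sum_fiberwise Finset.univ (Quotient.mk s)
    (fun x => 1 + if γ x = x then 1 else 0)
  simp only [fiber, Finset.sum_const, Finset.card_univ, smul_eq_mul, Finset.sum_add_distrib,
    Finset.sum_boole, mul_one] at total
  rw [numCycles, Nat.card_eq_fintype_card, Nat.card_eq_fintype_card, Nat.card_eq_fintype_card,
    Fintype.card_subtype, mul_comm]
  exact_mod_cast total

end Cycles

section FirstReturn

variable {H ι : Type*} [Finite H]

theorem firstReturn_apply (f : Equiv.Perm H) (p : H → ι) (x : H) :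
    firstReturn f p x = f^[firstReturnTime f p x] x := rfl

theorem firstReturn_sameCycle (f : Equiv.Perm H) (p : H → ι) (x : H) :
    f.SameCycle x (firstReturn f p x) :=
  sameCycle_iff_exists_iterate.2 ⟨_, rfl⟩

theorem firstReturn_eq_iterate (f : Equiv.Perm H) (p : H → ι) {x : H} {k : ℕ} (hk : 0 < k)
    (h : p (f^[k] x) = p x) (hlt : ∀ j, 0 < j → j < k → p (f^[j] x) ≠ p x) :
    firstReturn f p x = f^[k] x := by
  obtain ⟨hpos, hreturn⟩ := firstReturnTime_spec f p x
  have hle : k ≤ firstReturnTime f p x := not_lt.1 fun hlt' => hlt _ hpos hlt' hreturn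
  rw [firstReturn_apply, (firstReturnTime_le f p x hk h).antisymm hle]

theorem firstReturn_eq_of_apply (f : Equiv.Perm H) (p : H → ι) {x : H} (h : p (f x) = p x) :
    firstReturn f p x = f x :=
  firstReturn_eq_iterate f p (k := 1) one_pos h (by omega)

theorem sameCycle_firstReturn_iff (f : Equiv.Perm H) (p : H → ι) {x y : H} :
    (firstReturn f p).SameCycle x y ↔ f.SameCycle x y ∧ p x = p y := by
  constructor
  · intro h
    refine (mem_iff_of_sameCycle (s := {y | f.SameCycle x y ∧ p x = p y}) ?_ h).1 ⟨.refl _ _, rfl⟩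
    rintro y ⟨hxy, hp⟩
    exact ⟨hxy.trans (firstReturn_sameCycle _ _ _), hp.trans (firstReturn_class f p y).symm⟩
  · rintro ⟨h, hp⟩
    obtain ⟨k, rfl⟩ := sameCycle_iff_exists_iterate.1 h
    clear h
    induction k using Nat.strong_induction_on generalizing x with
    | _ k ih =>
      rcases Nat.eq_zero_or_pos k with rfl | hk
      · exact .refl _ _
      have hle := firstReturnTime_le f p x hk hp.symm
      have hpos := (firstReturnTime_spec f p x).1
      have hsplit : f^[k] x = f^[k - firstReturnTime f p x] (firstReturn f p x) := by
        rw [firstReturn_apply, ← Function.iterate_add_apply, Nat.sub_add_cancel hle]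
      rw [hsplit] at hp ⊢
      exact (sameCycle_apply_right.2 (.refl _ _)).trans
        (ih _ (by omega) ((firstReturn_class f p x).trans hp))

end FirstReturn

section CyclicDist

variable {H : Type*}

/-- The cyclic distance from `x` to `y`: the number of steps that `τ` takes from `x` to `y`. It is
only used when `τ` has a single cycle, and equals `0` if `y` is not reached. -/
noncomputable def cyclicDist (τ : Equiv.Perm H) (x y : H) : ℕ := sInf {k | τ^[k] x = y}

variable [Finite H] {τ : Equiv.Perm H} (hτ : ∀ x y, τ.SameCycle x y)

include hτ

theorem iterate_cyclicDist (x y : H) : τ^[cyclicDist τ x y] x = y :=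
  Nat.sInf_mem (sameCycle_iff_exists_iterate.1 (hτ x y))

theorem minimalPeriod_eq_card (x : H) : Function.minimalPeriod τ x = Nat.card H := by
  have hpos : 0 < Function.minimalPeriod τ x :=
    Function.minimalPeriod_pos_of_mem_periodicPts (τ.injective.mem_periodicPts x)
  have hbij : Function.Bijective fun k : Fin (Function.minimalPeriod τ x) => τ^[k] x := by
    refine ⟨fun j k h => Fin.ext (Function.iterate_injOn_Iio_minimalPeriod j.2 k.2 h), fun y => ?_⟩
    obtain ⟨k, rfl⟩ := sameCycle_iff_exists_iterate.1 (hτ x y)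
    exact ⟨⟨_, k.mod_lt hpos⟩, Function.iterate_mod_minimalPeriod_eq⟩
  rw [← Nat.card_congr (Equiv.ofBijective _ hbij), Nat.card_fin]

theorem cyclicDist_iterate (x : H) (k : ℕ) : cyclicDist τ x (τ^[k] x) = k % Nat.card H := by
  have hcard := minimalPeriod_eq_card hτ x
  have hpos : 0 < Nat.card H := Nat.card_pos_iff.2 ⟨⟨x⟩, inferInstance⟩
  have hle : cyclicDist τ x (τ^[k] x) ≤ k % Nat.card H :=
    Nat.sInf_le (by rw [Set.mem_ofPred_eq, ← hcard, Function.iterate_mod_minimalPeriod_eq])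
  refine Function.iterate_injOn_Iio_minimalPeriod (f := τ) (x := x)
    (hcard.symm ▸ hle.trans_lt (k.mod_lt hpos)) (hcard.symm ▸ k.mod_lt hpos) ?_
  dsimp only
  rw [iterate_cyclicDist hτ, ← hcard, Function.iterate_mod_minimalPeriod_eq]

theorem cyclicDist_iterate_of_lt (x : H) {k : ℕ} (hk : k < Nat.card H) :
    cyclicDist τ x (τ^[k] x) = k := by
  rw [cyclicDist_iterate hτ, Nat.mod_eq_of_lt hk]

theorem cyclicDist_self (x : H) : cyclicDist τ x x = 0 := by
  simpa using cyclicDist_iterate hτ x 0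

theorem cyclicDist_lt_card (x y : H) : cyclicDist τ x y < Nat.card H := by
  conv_lhs => rw [← iterate_cyclicDist hτ x y, cyclicDist_iterate hτ]
  exact Nat.mod_lt _ (Nat.card_pos_iff.2 ⟨⟨x⟩, inferInstance⟩)

theorem cyclicDist_injective (x : H) : Function.Injective (cyclicDist τ x) := fun y z h => by
  rw [← iterate_cyclicDist hτ x y, h, iterate_cyclicDist hτ]

theorem cyclicDist_eq_zero_iff {x y : H} : cyclicDist τ x y = 0 ↔ x = y := by
  rw [← cyclicDist_self hτ x, (cyclicDist_injective hτ x).eq_iff, eq_comm]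

theorem cyclicDist_apply {x y : H} (h : τ y ≠ x) :
    cyclicDist τ x (τ y) = cyclicDist τ x y + 1 := by
  have hmod : cyclicDist τ x (τ y) = (cyclicDist τ x y + 1) % Nat.card H := by
    rw [← cyclicDist_iterate hτ x, Function.iterate_succ_apply', iterate_cyclicDist hτ]
  have hne : cyclicDist τ x (τ y) ≠ 0 := fun h0 => h ((cyclicDist_eq_zero_iff hτ).1 h0).symm
  rcases (Nat.succ_le_of_lt (cyclicDist_lt_card hτ x y)).lt_or_eq with hlt | heq
  · rw [hmod, Nat.mod_eq_of_lt hlt]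
  · rw [hmod, ← heq, Nat.mod_self] at hne
    exact absurd rfl hne

theorem cyclicDist_le_of_apply_eq {x z : H} (h : τ z = x) (y : H) :
    cyclicDist τ x y ≤ cyclicDist τ x z := by
  by_contra! hlt
  have hround := cyclicDist_iterate_of_lt hτ x
    (Nat.lt_of_le_of_lt (Nat.succ_le_of_lt hlt) (cyclicDist_lt_card hτ x y))
  rw [Function.iterate_succ_apply', iterate_cyclicDist hτ, h, cyclicDist_self hτ] at hround
  exact Nat.succ_ne_zero _ hround.symm

theorem cyclicDist_add (x y z : H) :
    cyclicDist τ x y ≤ cyclicDist τ x z ∧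
        cyclicDist τ x y + cyclicDist τ y z = cyclicDist τ x z ∨
      cyclicDist τ x z < cyclicDist τ x y ∧
        cyclicDist τ x y + cyclicDist τ y z = cyclicDist τ x z + Nat.card H := by
  have hmod : cyclicDist τ x z = (cyclicDist τ x y + cyclicDist τ y z) % Nat.card H := by
    rw [← cyclicDist_iterate hτ x, add_comm, Function.iterate_add_apply, iterate_cyclicDist hτ,
      iterate_cyclicDist hτ]
  have := cyclicDist_lt_card hτ x y
  have := cyclicDist_lt_card hτ y z
  rcases lt_or_ge (cyclicDist τ x y + cyclicDist τ y z) (Nat.card H) with h | h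
  · rw [Nat.mod_eq_of_lt h] at hmod
    omega
  · rw [Nat.mod_eq_sub_mod h, Nat.mod_eq_of_lt (by omega)] at hmod
    omega

theorem cyclicDist_le_cyclicDist_iff {r x z : H} (h : cyclicDist τ r x ≤ cyclicDist τ r z) (y : H) :
    cyclicDist τ x y ≤ cyclicDist τ x z ↔
      cyclicDist τ r x ≤ cyclicDist τ r y ∧ cyclicDist τ r y ≤ cyclicDist τ r z := by
  have := cyclicDist_add hτ r x y
  have := cyclicDist_add hτ r x z
  have := cyclicDist_lt_card hτ r z
  omega

end CyclicDist

section NonCrossingFactor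

variable {H : Type*}

/-- The functions that are constant on the cycles of a permutation. -/
def invariantFunctions (β : Equiv.Perm H) : Submodule ℚ (H → ℚ) :=
  LinearMap.eqLocus (LinearMap.funLeft ℚ ℚ β) LinearMap.id

theorem mem_invariantFunctions {β : Equiv.Perm H} {v : H → ℚ} :
    v ∈ invariantFunctions β ↔ ∀ x, v (β x) = v x :=
  LinearMap.mem_eqLocus.trans funext_iff

theorem apply_eq_of_sameCycle [Finite H] {β : Equiv.Perm H} {v : H → ℚ}
    (hv : v ∈ invariantFunctions β) {x y : H} (h : β.SameCycle x y) : v y = v x :=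
  (mem_iff_of_sameCycle (s := {z | v z = v x})
    (fun z hz => (mem_invariantFunctions.1 hv z).trans hz) h).1 rfl

theorem finrank_invariantFunctions [Finite H] (β : Equiv.Perm H) :
    Module.finrank ℚ (invariantFunctions β) = numCycles β := by
  let s : Setoid H := Equiv.Perm.SameCycle.setoid β
  have := Fintype.ofFinite (Quotient s)
  have hrange : invariantFunctions β = LinearMap.range (LinearMap.funLeft ℚ ℚ (Quotient.mk s)) := by
    ext v
    constructor
    · intro hv
      exact ⟨Quotient.lift v fun x y h => (apply_eq_of_sameCycle hv h).symm, rfl⟩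
    · rintro ⟨v, rfl⟩
      exact mem_invariantFunctions.2 fun x =>
        congrArg v (Quotient.sound (sameCycle_apply_left.2 (.refl _ _)))
  rw [hrange, LinearMap.finrank_range_of_inj
    (LinearMap.funLeft_injective_of_surjective ℚ ℚ _ Quotient.mk_surjective),
    Module.finrank_fintype_fun_eq_card, numCycles, Nat.card_eq_fintype_card]

theorem invariantFunctions_inf_mul [Finite H] {τ : Equiv.Perm H} (hτ : ∀ x y, τ.SameCycle x y)
    (β : Equiv.Perm H) :
    invariantFunctions β ⊓ invariantFunctions (τ * β) = invariantFunctions τ := by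
  ext v
  rw [Submodule.mem_inf]
  constructor
  · rintro ⟨hβ, hτβ⟩
    rw [mem_invariantFunctions] at *
    intro x
    obtain ⟨y, rfl⟩ := β.surjective x
    exact (hτβ y).trans (hβ y).symm
  · intro hv
    exact ⟨mem_invariantFunctions.2 fun x => apply_eq_of_sameCycle hv (hτ _ _),
      mem_invariantFunctions.2 fun x => apply_eq_of_sameCycle hv (hτ _ _)⟩

theorem numCycles_add_numCycles_mul_eq_iff_sup_eq_top [Finite H] [Nonempty H] {τ : Equiv.Perm H}
    (hτ : ∀ x y, τ.SameCycle x y) (β : Equiv.Perm H) :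
    numCycles β + numCycles (τ * β) = Nat.card H + 1 ↔
      invariantFunctions β ⊔ invariantFunctions (τ * β) = ⊤ := by
  have := Fintype.ofFinite H
  have hdim := Submodule.finrank_sup_add_finrank_inf_eq (invariantFunctions β)
    (invariantFunctions (τ * β))
  rw [invariantFunctions_inf_mul hτ, finrank_invariantFunctions, finrank_invariantFunctions,
    finrank_invariantFunctions, numCycles_eq_one_iff.2 hτ] at hdim
  rw [Submodule.eq_top_iff_finrank_eq, ← hdim, Module.finrank_fintype_fun_eq_card,
    Nat.card_eq_fintype_card, Nat.add_right_cancel_iff]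

/-- The cycles of `β` form a non-crossing partition with respect to the cyclic order given by `τ`,
and `β` runs backwards along each of them: the arc from `x` to `β x` contains, with any of its
points, the image of this point by `β`. -/
def IsNonCrossingFactor (τ β : Equiv.Perm H) : Prop :=
  ∀ x y, cyclicDist τ x y ≤ cyclicDist τ x (β x) → cyclicDist τ x (β y) ≤ cyclicDist τ x (β x)

theorem IsNonCrossingFactor.sameCycle_arc [Finite H] {τ β : Equiv.Perm H}
    (h : IsNonCrossingFactor τ β) (x : H) {y z : H} (hyz : β.SameCycle y z) :
    cyclicDist τ x y ≤ cyclicDist τ x (β x) ↔ cyclicDist τ x z ≤ cyclicDist τ x (β x) :=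
  mem_iff_of_sameCycle (s := {y | cyclicDist τ x y ≤ cyclicDist τ x (β x)}) (h x) hyz

variable [Finite H] {τ β : Equiv.Perm H} (hτ : ∀ x y, τ.SameCycle x y)

include hτ

theorem IsNonCrossingFactor.of_sup_eq_top
    (h : invariantFunctions β ⊔ invariantFunctions (τ * β) = ⊤) : IsNonCrossingFactor τ β := by
  classical
  intro x y hy
  obtain ⟨u, hu, w, hw, huw⟩ :=
    Submodule.mem_sup.1 (h ▸ Submodule.mem_top (x := Pi.single x (1 : ℚ)))
  have step (z : H) : u (τ z) - u z = (if τ z = x then 1 else 0) - if z = β x then 1 else 0 := by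
    obtain ⟨z, rfl⟩ := β.surjective z
    have h1 := congrFun huw (τ (β z))
    have h2 := congrFun huw z
    have hw' : w (τ (β z)) = w z := mem_invariantFunctions.1 hw z
    have hu' := mem_invariantFunctions.1 hu z
    simp only [Pi.add_apply, Pi.single_apply, β.injective.eq_iff] at h1 h2 ⊢
    linarith
  have arc (k : ℕ) (hk : k < Nat.card H) :
      u (τ^[k] x) = if k ≤ cyclicDist τ x (β x) then u x else u x - 1 := by
    induction k with
    | zero => simp
    | succ k ih =>
      have h1 : τ (τ^[k] x) ≠ x := fun h1 => by
        rw [← Function.iterate_succ_apply' (f := τ)] at h1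
        simpa [h1, cyclicDist_self hτ] using cyclicDist_iterate_of_lt hτ x hk
      have h2 : τ^[k] x = β x ↔ k = cyclicDist τ x (β x) := by
        rw [← (cyclicDist_injective hτ x).eq_iff, cyclicDist_iterate_of_lt hτ x (by omega)]
      have := step (τ^[k] x)
      rw [if_neg h1, ih (by omega)] at this
      simp only [h2] at this
      rw [Function.iterate_succ_apply']
      grind
  have mem_arc_iff (z : H) : cyclicDist τ x z ≤ cyclicDist τ x (β x) ↔ u z = u x := by
    have := arc _ (cyclicDist_lt_card hτ x z)
    rw [iterate_cyclicDist hτ] at this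
    grind
  rw [mem_arc_iff] at hy ⊢
  rw [mem_invariantFunctions.1 hu, hy]

theorem IsNonCrossingFactor.sup_eq_top (h : IsNonCrossingFactor τ β) :
    invariantFunctions β ⊔ invariantFunctions (τ * β) = ⊤ := by
  classical
  have := Fintype.ofFinite H
  have single_mem (x : H) :
      Pi.single x (1 : ℚ) ∈ invariantFunctions β ⊔ invariantFunctions (τ * β) := by
    let u : H → ℚ := fun y => if cyclicDist τ x y ≤ cyclicDist τ x (β x) then 1 else 0
    have hu : u ∈ invariantFunctions β := mem_invariantFunctions.2 fun y => by
      simp only [u, h.sameCycle_arc x (sameCycle_apply_left.2 (.refl β y))]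
    have step (z : H) : u (τ z) - u z = (if τ z = x then 1 else 0) - if z = β x then 1 else 0 := by
      have h1 := (cyclicDist_injective hτ x).eq_iff (a := z) (b := β x)
      by_cases hz : τ z = x
      · have h2 := cyclicDist_le_of_apply_eq hτ hz (β x)
        have h3 := cyclicDist_self hτ x
        grind
      · have h2 := cyclicDist_apply hτ hz
        grind
    have hw : Pi.single x 1 - u ∈ invariantFunctions (τ * β) := mem_invariantFunctions.2 fun y => by
      have h1 := mem_invariantFunctions.1 hu y
      have h2 := step (β y)
      simp only [β.injective.eq_iff, Pi.sub_apply, Pi.single_apply, Equiv.Perm.mul_apply] at h2 ⊢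
      linarith
    simpa using Submodule.add_mem_sup hu hw
  rw [eq_top_iff, ← (Pi.basisFun ℚ H).span_eq, Submodule.span_le]
  rintro _ ⟨x, rfl⟩
  rw [Pi.basisFun_apply]
  exact single_mem x

/-- Biane's characterization of the factorizations of a long cycle of genus `0`. -/
theorem isNonCrossingFactor_iff [Nonempty H] : IsNonCrossingFactor τ β ↔
    numCycles β + numCycles (τ * β) = Nat.card H + 1 := by
  rw [numCycles_add_numCycles_mul_eq_iff_sup_eq_top hτ]
  exact ⟨fun h => h.sup_eq_top hτ, .of_sup_eq_top hτ⟩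

end NonCrossingFactor

section NonCrossingFactorOrder

variable {H : Type*} [Finite H] {τ β : Equiv.Perm H}

theorem IsNonCrossingFactor.cyclicDist_le (h : IsNonCrossingFactor τ β)
    (hτ : ∀ x y, τ.SameCycle x y) {x y : H} (hxy : β.SameCycle x y) :
    cyclicDist τ x y ≤ cyclicDist τ x (β x) :=
  (h.sameCycle_arc x hxy).1 ((cyclicDist_self hτ x).trans_le (Nat.zero_le _))

theorem IsNonCrossingFactor.apply_eq_of_forall_le (h : IsNonCrossingFactor τ β)
    (hτ : ∀ x y, τ.SameCycle x y) {x y : H} (hxy : β.SameCycle x y)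
    (hmax : ∀ z, β.SameCycle x z → cyclicDist τ x z ≤ cyclicDist τ x y) : β x = y :=
  cyclicDist_injective hτ x ((hmax _ (sameCycle_apply_right.2 (.refl _ _))).antisymm
    (h.cyclicDist_le hτ hxy))

theorem IsNonCrossingFactor.mul_mem_arc (h : IsNonCrossingFactor τ β)
    (hτ : ∀ x y, τ.SameCycle x y) {x y : H} (hyx : y ≠ x)
    (hy : cyclicDist τ x y ≤ cyclicDist τ x (β x)) :
    (τ * β) y ≠ x ∧ cyclicDist τ x ((τ * β) y) ≤ cyclicDist τ x (β x) := by
  have hle := h x y hy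
  have hne : cyclicDist τ x (β y) ≠ cyclicDist τ x (β x) := fun heq =>
    hyx (β.injective (cyclicDist_injective hτ x heq))
  have hmul : τ (β y) ≠ x := fun heq =>
    hne (hle.antisymm (cyclicDist_le_of_apply_eq hτ heq _))
  refine ⟨hmul, ?_⟩
  rw [Equiv.Perm.mul_apply, cyclicDist_apply hτ hmul]
  omega

theorem IsNonCrossingFactor.sameCycle_of_lt_of_lt (h : IsNonCrossingFactor τ β)
    (hτ : ∀ x y, τ.SameCycle x y) {r a b c d : H}
    (hab : cyclicDist τ r a < cyclicDist τ r b) (hbc : cyclicDist τ r b < cyclicDist τ r c)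
    (hcd : cyclicDist τ r c < cyclicDist τ r d) (hac : β.SameCycle a c)
    (hbd : β.SameCycle b d) : β.SameCycle a b := by
  by_contra hnab
  obtain ⟨y, ⟨hay, hby⟩, hmin⟩ := WellFounded.has_min
    (InvImage.wf (cyclicDist τ r) wellFounded_lt)
    {y | β.SameCycle a y ∧ cyclicDist τ r b < cyclicDist τ r y} ⟨c, hac, hbc⟩
  have hyc := not_lt.1 (hmin c ⟨hac, hbc⟩)
  have hβy : β.SameCycle a (β y) := hay.apply_right
  have hmin' : cyclicDist τ r b < cyclicDist τ r (β y) →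
      cyclicDist τ r y ≤ cyclicDist τ r (β y) := fun hlt => not_lt.1 (hmin _ ⟨hβy, hlt⟩)
  have hne : cyclicDist τ r (β y) ≠ cyclicDist τ r b := fun heq =>
    hnab (cyclicDist_injective hτ r heq ▸ hβy)
  have hya := h.cyclicDist_le hτ hay.symm
  have hcross := h.sameCycle_arc y hbd
  have := cyclicDist_add hτ r y a
  have := cyclicDist_add hτ r y b
  have := cyclicDist_add hτ r y d
  have := cyclicDist_add hτ r y (β y)
  have := cyclicDist_lt_card hτ r d
  have := cyclicDist_lt_card hτ r (β y)
  omega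

end NonCrossingFactorOrder

section Conj

variable {H H' : Type*} {e : H ≃ H'}

theorem iterate_conj {f : H → H} {g : H' → H'} (hfg : ∀ x, e (f x) = g (e x)) (k : ℕ) (x : H) :
    e (f^[k] x) = g^[k] (e x) :=
  (Function.Semiconj.iterate_right (f := e) hfg k) x

theorem cyclicDist_conj {τ : Equiv.Perm H} {τ' : Equiv.Perm H'} (hτ : ∀ x, e (τ x) = τ' (e x))
    (x y : H) : cyclicDist τ' (e x) (e y) = cyclicDist τ x y := by
  simp only [cyclicDist, ← iterate_conj hτ, e.apply_eq_iff_eq]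

theorem IsNonCrossingFactor.conj_apply [Finite H] [Finite H'] {τ β : Equiv.Perm H}
    {τ' β' : Equiv.Perm H'} (h : IsNonCrossingFactor τ β) (h' : IsNonCrossingFactor τ' β')
    (hτ : ∀ x y, τ.SameCycle x y) (hτ' : ∀ x y, τ'.SameCycle x y)
    (hconj : ∀ x, e (τ x) = τ' (e x))
    (hsame : ∀ x y, β'.SameCycle (e x) (e y) ↔ β.SameCycle x y) (x : H) :
    e (β x) = β' (e x) := by
  refine (h'.apply_eq_of_forall_le hτ' ((hsame _ _).2 (sameCycle_apply_right.2 (.refl _ _)))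
    fun z hz => ?_).symm
  obtain ⟨z, rfl⟩ := e.surjective z
  rw [cyclicDist_conj hconj, cyclicDist_conj hconj]
  exact h.cyclicDist_le hτ ((hsame _ _).1 hz)

end Conj

namespace MapData

variable {H : Type*}

theorem Joined.mem_iff {M : MapData H} {S W : Set H} (hrot : ∀ x, M.rot x ∈ W ↔ x ∈ W)
    (hedge : ∀ x ∈ S, M.edge x ∈ W ↔ x ∈ W) {x y : H} (h : M.Joined S x y) : x ∈ W ↔ y ∈ W := by
  induction h with
  | rel x y h =>
    rcases h with rfl | ⟨hx, rfl⟩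
    · exact (hrot x).symm
    · exact (hedge x hx).symm
  | refl => rfl
  | symm _ _ _ ih => exact ih.symm
  | trans _ _ _ _ _ ih₁ ih₂ => exact ih₁.trans ih₂

theorem joined_rot (M : MapData H) (S : Set H) (x : H) : M.Joined S x (M.rot x) :=
  .rel _ _ (.inl rfl)

theorem joined_edge (M : MapData H) {S : Set H} {x : H} (hx : x ∈ S) : M.Joined S x (M.edge x) :=
  .rel _ _ (.inr ⟨hx, rfl⟩)

theorem tour_succ (M : MapData H) (T : Set H) (k : ℕ) :
    M.tour T (k + 1) = M.tourStep T (M.tour T k) :=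
  Function.iterate_succ_apply' ..

theorem joined_tourStep (M : MapData H) {S T : Set H} {x : H} (h : x ∈ T → x ∈ S) :
    M.Joined S x (M.tourStep T x) := by
  rw [tourStep]
  split_ifs with hx
  · exact (M.joined_edge (h hx)).trans _ _ _ (M.joined_rot S _)
  · exact M.joined_rot S x

theorem numEdges_add_one [Finite H] (M : MapData H) : M.numEdges + 1 = numCycles M.edge := by
  classical
  have := Fintype.ofFinite (Quotient (SameCycle.setoid M.edge))
  have hpos : 0 < Fintype.card (Quotient (SameCycle.setoid M.edge)) :=
    Fintype.card_pos_iff.2 ⟨Quotient.mk _ M.root⟩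
  rw [numEdges, numCycles, Nat.card_eq_fintype_card, Nat.card_eq_fintype_card,
    Fintype.card_subtype_compl, Fintype.card_subtype_eq]
  omega

theorem two_mul_numEdges_add_one [Finite H] {M : MapData H} (hedge : ∀ x, M.edge (M.edge x) = x)
    (hroot : ∀ x, M.edge x = x ↔ x = M.root) : 2 * M.numEdges + 1 = Nat.card H := by
  have hcycles := two_mul_numCycles hedge
  simp only [hroot, Nat.card_unique] at hcycles
  have := M.numEdges_add_one
  omega

/-- The set of half-edges `T` and the involution `α` that exchanges the two halves of the edges in
`T` describe a spanning tree through its tour `M.rot * α`: this permutation has a single cycle, and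
the edges in `T` are the arcs of a non-crossing matching around it. -/
structure IsTreeTour (M : MapData H) (T : Set H) (α : Equiv.Perm H) : Prop where
  edge_edge : ∀ x, M.edge (M.edge x) = x
  edge_eq_self_iff : ∀ x, M.edge x = x ↔ x = M.root
  root_mem : M.root ∈ T
  apply_of_mem : ∀ x ∈ T, α x = M.edge x
  apply_of_notMem : ∀ x ∉ T, α x = x
  sameCycle : ∀ x y, (M.rot * α).SameCycle x y
  isNonCrossingFactor : IsNonCrossingFactor (M.rot * α) α

/-- The time at which the half-edge `x` is met by the tour `M.rot * α`. -/
noncomputable def tourTime (M : MapData H) (α : Equiv.Perm H) (x : H) : ℕ :=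
  cyclicDist (M.rot * α) M.root x

namespace IsTreeTour

variable {M : MapData H} {T : Set H} {α : Equiv.Perm H}

theorem edge_root (h : M.IsTreeTour T α) : M.edge M.root = M.root :=
  (h.edge_eq_self_iff _).2 rfl

theorem edge_ne_self (h : M.IsTreeTour T α) {x : H} (hx : x ≠ M.root) : M.edge x ≠ x :=
  mt (h.edge_eq_self_iff x).1 hx

theorem edge_ne_root (h : M.IsTreeTour T α) {x : H} (hx : x ≠ M.root) : M.edge x ≠ M.root :=
  fun heq => hx (by rw [← h.edge_edge x, heq, h.edge_root])

theorem edge_mem (h : M.IsTreeTour T α) {x : H} (hx : x ∈ T) : M.edge x ∈ T := by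
  by_contra hnot
  have hfix : M.edge x = x := α.injective (by rw [h.apply_of_notMem _ hnot, h.apply_of_mem x hx])
  exact hnot (hfix.symm ▸ hx)

theorem edge_mem_iff (h : M.IsTreeTour T α) {x : H} : M.edge x ∈ T ↔ x ∈ T :=
  ⟨fun hx => h.edge_edge x ▸ h.edge_mem hx, h.edge_mem⟩

theorem apply_apply (h : M.IsTreeTour T α) (x : H) : α (α x) = x := by
  by_cases hx : x ∈ T
  · rw [h.apply_of_mem x hx, h.apply_of_mem _ (h.edge_mem hx), h.edge_edge]
  · rw [h.apply_of_notMem x hx, h.apply_of_notMem x hx]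

theorem mul_apply_of_mem (h : M.IsTreeTour T α) {x : H} (hx : x ∈ T) :
    (M.rot * α) x = M.rot (M.edge x) := by
  rw [Equiv.Perm.mul_apply, h.apply_of_mem x hx]

theorem mul_apply_of_notMem (h : M.IsTreeTour T α) {x : H} (hx : x ∉ T) :
    (M.rot * α) x = M.rot x := by
  rw [Equiv.Perm.mul_apply, h.apply_of_notMem x hx]

theorem tourStep_eq (h : M.IsTreeTour T α) (x : H) : M.tourStep T x = (M.rot * α) x := by
  rw [tourStep]
  split_ifs with hx
  · exact (h.mul_apply_of_mem hx).symm
  · exact (h.mul_apply_of_notMem hx).symm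

theorem tour_eq_iterate (h : M.IsTreeTour T α) (k : ℕ) : M.tour T k = (M.rot * α)^[k] M.root := by
  rw [tour, funext h.tourStep_eq]

variable [Finite H]

theorem tour_tourTime (h : M.IsTreeTour T α) (x : H) : M.tour T (M.tourTime α x) = x := by
  rw [h.tour_eq_iterate, tourTime, iterate_cyclicDist h.sameCycle]

theorem tourTime_tour (h : M.IsTreeTour T α) {k : ℕ} (hk : k < Nat.card H) :
    M.tourTime α (M.tour T k) = k := by
  rw [h.tour_eq_iterate, tourTime, cyclicDist_iterate_of_lt h.sameCycle _ hk]

theorem tourTime_lt_card (h : M.IsTreeTour T α) (x : H) : M.tourTime α x < Nat.card H :=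
  cyclicDist_lt_card h.sameCycle _ _

theorem tourTime_injective (h : M.IsTreeTour T α) : Function.Injective (M.tourTime α) :=
  cyclicDist_injective h.sameCycle _

theorem tourTime_root (h : M.IsTreeTour T α) : M.tourTime α M.root = 0 :=
  cyclicDist_self h.sameCycle _

theorem tourTime_pos (h : M.IsTreeTour T α) {x : H} (hx : x ≠ M.root) : 0 < M.tourTime α x :=
  Nat.pos_of_ne_zero fun h0 => hx ((cyclicDist_eq_zero_iff h.sameCycle).1 h0).symm

theorem tourTime_edge_ne (h : M.IsTreeTour T α) {x : H} (hx : x ≠ M.root) :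
    M.tourTime α (M.edge x) ≠ M.tourTime α x :=
  h.tourTime_injective.ne (h.edge_ne_self hx)

theorem precedes_iff (h : M.IsTreeTour T α) {x y : H} :
    M.Precedes T x y ↔ M.tourTime α x < M.tourTime α y := by
  constructor
  · rintro ⟨k, rfl, hk⟩
    have hlt : k < M.tourTime α y := not_le.1 fun hle => hk _ hle (h.tour_tourTime y)
    rwa [h.tourTime_tour (hlt.trans (h.tourTime_lt_card y))]
  · intro hlt
    refine ⟨_, h.tour_tourTime x, fun j hj hy => ?_⟩
    rw [← hy, h.tourTime_tour (hj.trans_lt (h.tourTime_lt_card x))] at hlt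
    omega

/-- The arc of the tour between the two halves of an edge of the tree is the border of a subtree. -/
theorem sameVertex_between_iff (h : M.IsTreeTour T α) {x y z : H} (hx : x ∈ T)
    (hlt : M.tourTime α x < M.tourTime α (M.edge x)) (hyz : M.SameVertex y z) :
    M.tourTime α x < M.tourTime α y ∧ M.tourTime α y ≤ M.tourTime α (M.edge x) ↔
      M.tourTime α x < M.tourTime α z ∧ M.tourTime α z ≤ M.tourTime α (M.edge x) := by
  have hrot : M.rot * α * α = M.rot := by
    ext y
    simp [h.apply_apply]
  have arc (y : H) : y ∈ {y | y ≠ x ∧ cyclicDist (M.rot * α) x y ≤ cyclicDist (M.rot * α) x (α x)} ↔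
      M.tourTime α x < M.tourTime α y ∧ M.tourTime α y ≤ M.tourTime α (M.edge x) := by
    rw [Set.mem_ofPred, h.apply_of_mem x hx, cyclicDist_le_cyclicDist_iff h.sameCycle hlt.le,
      ← h.tourTime_injective.ne_iff, tourTime, tourTime, tourTime]
    omega
  rw [← arc, ← arc]
  refine mem_iff_of_sameCycle (fun y hy => ?_) hyz
  have := h.isNonCrossingFactor.mul_mem_arc h.sameCycle hy.1 hy.2
  rwa [hrot] at this

theorem edge_between (h : M.IsTreeTour T α) {x y : H} (hx : x ∈ T) (hy : y ∈ T)
    (hxy : M.tourTime α x < M.tourTime α y) (hyx : M.tourTime α y < M.tourTime α (M.edge x)) :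
    M.tourTime α x < M.tourTime α (M.edge y) ∧
      M.tourTime α (M.edge y) < M.tourTime α (M.edge x) := by
  have harc := h.isNonCrossingFactor x y
  rw [h.apply_of_mem x hx, h.apply_of_mem y hy,
    cyclicDist_le_cyclicDist_iff h.sameCycle (r := M.root) (hxy.trans hyx).le,
    cyclicDist_le_cyclicDist_iff h.sameCycle (r := M.root) (hxy.trans hyx).le] at harc
  have hne : M.tourTime α (M.edge y) ≠ M.tourTime α (M.edge x) := fun heq =>
    hxy.ne' (congrArg _ (M.edge.injective (h.tourTime_injective heq)))
  have hne' : M.tourTime α (M.edge y) ≠ M.tourTime α x := fun heq =>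
    hyx.ne (by rw [← h.tourTime_injective heq, h.edge_edge])
  simp only [tourTime] at *
  omega

theorem joined_root_of_tourTime_lt (h : M.IsTreeTour T α) {x : H}
    (hlt : M.tourTime α x < M.tourTime α (M.edge x)) :
    M.Joined (T \ {x, M.edge x}) M.root x := by
  have along (k : ℕ) (hk : k ≤ M.tourTime α x) :
      M.Joined (T \ {x, M.edge x}) M.root (M.tour T k) := by
    induction k with
    | zero => exact .refl _
    | succ k ih =>
      refine (ih (by omega)).trans _ _ _ ?_
      rw [tour_succ]
      have htime := h.tourTime_tour ((Nat.lt_of_succ_le hk).trans (h.tourTime_lt_card x))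
      refine M.joined_tourStep fun hmem => ⟨hmem, ?_⟩
      rintro (heq | heq) <;> rw [heq] at htime <;> omega
  simpa only [h.tour_tourTime] using along _ le_rfl

theorem not_joined_root_of_tourTime_lt (h : M.IsTreeTour T α) {x : H} (hx : x ∈ T)
    (hlt : M.tourTime α (M.edge x) < M.tourTime α x) :
    ¬ M.Joined (T \ {x, M.edge x}) M.root x := by
  set W := {y | M.tourTime α (M.edge x) < M.tourTime α y ∧ M.tourTime α y ≤ M.tourTime α x}
  have hlt' : M.tourTime α (M.edge x) < M.tourTime α (M.edge (M.edge x)) := by rwa [h.edge_edge]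
  have hrot (y : H) : M.rot y ∈ W ↔ y ∈ W := by
    have := h.sameVertex_between_iff (h.edge_mem hx) hlt' (sameCycle_apply_left.2 (.refl M.rot y))
    rwa [h.edge_edge] at this
  have hedge (y : H) (hy : y ∈ T \ {x, M.edge x}) (hyW : y ∈ W) : M.edge y ∈ W := by
    have hne : M.tourTime α y ≠ M.tourTime α x :=
      h.tourTime_injective.ne fun heq => hy.2 (.inl heq)
    have := h.edge_between (h.edge_mem hx) hy.1 hyW.1
      (by rw [h.edge_edge]; exact lt_of_le_of_ne hyW.2 hne)
    rw [h.edge_edge] at this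
    exact ⟨this.1, this.2.le⟩
  have hedge_iff (y : H) (hy : y ∈ T \ {x, M.edge x}) : M.edge y ∈ W ↔ y ∈ W := by
    refine ⟨fun hyW => h.edge_edge y ▸ hedge _ ⟨h.edge_mem hy.1, ?_⟩ hyW, hedge y hy⟩
    rintro (heq | heq)
    · exact hy.2 (.inr (by rw [← heq, h.edge_edge]; rfl))
    · exact hy.2 (.inl (M.edge.injective heq))
  intro hjoined
  have hroot := ((hjoined.mem_iff hrot hedge_iff).2 ⟨hlt, le_rfl⟩).1
  rw [h.tourTime_root] at hroot
  omega

theorem mem_treeHeads_iff (h : M.IsTreeTour T α) {x : H} : x ∈ M.treeHeads T ↔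
    x = M.root ∨ (x ∈ T ∧ M.tourTime α (M.edge x) < M.tourTime α x) ∨
      (x ∉ T ∧ M.tourTime α x < M.tourTime α (M.edge x)) := by
  by_cases hroot : x = M.root
  · exact iff_of_true (.inl hroot) (.inl hroot)
  have hjoined (hx : x ∈ T) : ¬ M.Joined (T \ {x, M.edge x}) M.root x ↔
      M.tourTime α (M.edge x) < M.tourTime α x := by
    refine ⟨fun hnot => ?_, h.not_joined_root_of_tourTime_lt hx⟩
    exact lt_of_le_of_ne (not_lt.1 (mt h.joined_root_of_tourTime_lt hnot))
      (h.tourTime_edge_ne hroot)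
  rw [treeHeads, Set.mem_ofPred, and_congr_right hjoined, h.precedes_iff]

theorem root_mem_treeHeads (h : M.IsTreeTour T α) : M.root ∈ M.treeHeads T :=
  h.mem_treeHeads_iff.2 (.inl rfl)

theorem edge_mem_treeHeads_iff (h : M.IsTreeTour T α) {x : H} (hx : x ≠ M.root) :
    M.edge x ∈ M.treeHeads T ↔ x ∉ M.treeHeads T := by
  rw [h.mem_treeHeads_iff, h.mem_treeHeads_iff, h.edge_edge, h.edge_mem_iff]
  have := h.edge_ne_root hx
  have := h.tourTime_edge_ne hx
  grind

theorem mem_tree_iff (h : M.IsTreeTour T α) {x : H} : x ∈ T ↔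
    x = M.root ∨ (x ∈ M.treeHeads T ↔ M.tourTime α (M.edge x) < M.tourTime α x) := by
  by_cases hx : x = M.root
  · exact iff_of_true (hx ▸ h.root_mem) (.inl hx)
  have := h.tourTime_edge_ne hx
  rw [h.mem_treeHeads_iff]
  grind

end IsTreeTour

end MapData

namespace MapData

variable {H : Type*} [Finite H] {M : MapData H}

theorem joined_univ_of_sameCycle {x y : H} (h : (M.rot * M.edge).SameCycle x y) :
    M.Joined Set.univ x y := by
  refine (mem_iff_of_sameCycle (s := {y | M.Joined Set.univ x y}) (fun y hy => ?_) h).1 (.refl x)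
  exact (hy.trans _ _ _ (M.joined_edge trivial)).trans _ _ _ (M.joined_rot _ _)

theorem isPlaneTree_iff : M.IsPlaneTree ↔ (∀ x, M.edge (M.edge x) = x) ∧
    (∀ x, M.edge x = x ↔ x = M.root) ∧ (∀ x y, (M.rot * M.edge).SameCycle x y) ∧
      2 * M.numVertices = Nat.card H + 1 := by
  have : Nonempty H := ⟨M.root⟩
  constructor
  · rintro ⟨h, hfaces⟩
    have := two_mul_numEdges_add_one h.edge_edge h.edge_eq_self_iff
    have := h.euler
    exact ⟨h.edge_edge, h.edge_eq_self_iff, numCycles_eq_one_iff.1 hfaces, by omega⟩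
  · rintro ⟨hedge, hroot, hcycle, hvertices⟩
    have hfaces : M.numFaces = 1 := numCycles_eq_one_iff.2 hcycle
    have := two_mul_numEdges_add_one hedge hroot
    exact ⟨⟨hedge, hroot, fun x y => joined_univ_of_sameCycle (hcycle x y), by omega⟩, hfaces⟩

section Restrict

variable {T : Set H} {α : Equiv.Perm H} (hα : ∀ x ∈ T, α x = M.edge x) (hα' : ∀ x ∉ T, α x = x)

include hα hα'

theorem two_mul_numCycles_add_card (hedge : ∀ x, M.edge (M.edge x) = x)
    (hfix : ∀ x, M.edge x = x ↔ x = M.root) (hroot : M.root ∈ T)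
    (hT : ∀ x, M.edge x ∈ T ↔ x ∈ T) :
    2 * numCycles α + Nat.card T = 2 * Nat.card H + 1 := by
  have hinv (x : H) : α (α x) = x := by
    by_cases hx : x ∈ T
    · rw [hα x hx, hα _ ((hT x).2 hx), hedge]
    · rw [hα' x hx, hα' x hx]
  have hfixed : {x | α x = x} = insert M.root Tᶜ := by
    ext x
    by_cases hx : x ∈ T
    · simp [hx, hα x hx, hfix]
    · simp [hx, hα' x hx]
  have hcycles := two_mul_numCycles hinv
  have hcard : Nat.card {x // α x = x} = Tᶜ.ncard + 1 := by
    rw [← Set.ncard_insert_of_notMem (s := Tᶜ) (a := M.root) (by simpa), ← hfixed]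
    exact Nat.card_coe_set_eq _
  have := Set.ncard_add_ncard_compl T
  rw [Nat.card_coe_set_eq]
  omega

theorem firstReturn_mul_eq (hT : ∀ x, M.edge x ∈ T ↔ x ∈ T) {x : H} (hx : x ∈ T) :
    firstReturn (M.rot * α) (fun x => x ∈ T) x =
      firstReturn M.rot (fun x => x ∈ T) (M.edge x) := by
  set k := firstReturnTime M.rot (fun x => x ∈ T) (M.edge x) with hk
  obtain ⟨hpos, hreturn⟩ := firstReturnTime_spec M.rot (fun x => x ∈ T) (M.edge x)
  rw [← hk, eq_iff_iff, iff_true_right ((hT x).2 hx)] at hreturn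
  have hbefore (j : ℕ) (hj : 0 < j) (hjk : j < k) : M.rot^[j] (M.edge x) ∉ T := fun hmem =>
    hjk.not_ge (firstReturnTime_le _ _ _ hj (by simp [hmem, (hT x).2 hx]))
  have hiterate (j : ℕ) (hj : 0 < j) (hjk : j ≤ k) :
      (M.rot * α)^[j] x = M.rot^[j] (M.edge x) := by
    induction j, hj using Nat.le_induction with
    | base => simp [hα x hx]
    | succ j hj ih =>
      rw [Function.iterate_succ_apply', ih (by omega), Function.iterate_succ_apply',
        Equiv.Perm.mul_apply, hα' _ (hbefore j hj (by omega))]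
  rw [firstReturn_apply M.rot, ← hk, ← hiterate k hpos le_rfl]
  refine firstReturn_eq_iterate _ _ hpos ?_ fun j hj hjk => ?_
  · rw [hiterate k hpos le_rfl]
    simp [hreturn, hx]
  · rw [hiterate j hj hjk.le]
    simp [hbefore j hj hjk, hx]

omit [Finite H] hα in
/-- The tour turns around the current vertex until it meets the tree. -/
theorem exists_mem_iterate_iff (x : H) :
    (∃ k, (M.rot * α)^[k] x ∈ T) ↔ ∃ k, M.rot^[k] x ∈ T := by
  have agree (k : ℕ) (hk : (∀ j < k, (M.rot * α)^[j] x ∉ T) ∨ ∀ j < k, M.rot^[j] x ∉ T) :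
      (M.rot * α)^[k] x = M.rot^[k] x := by
    induction k with
    | zero => rfl
    | succ k ih =>
      have heq := ih (hk.imp (fun h j hj => h j (by omega)) fun h j hj => h j (by omega))
      have hnot : M.rot^[k] x ∉ T := hk.elim (fun h => heq ▸ h k k.lt_succ_self)
        fun h => h k k.lt_succ_self
      rw [Function.iterate_succ_apply', heq, Equiv.Perm.mul_apply, hα' _ hnot,
        Function.iterate_succ_apply']
  classical
  constructor
  · intro h
    exact ⟨_, agree _ (.inl fun j hj => Nat.find_min h hj) ▸ Nat.find_spec h⟩
  · intro h
    exact ⟨_, (agree _ (.inr fun j hj => Nat.find_min h hj)).symm ▸ Nat.find_spec h⟩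

omit hα in
theorem exists_mem_sameCycle_iff (x : H) :
    (∃ y ∈ T, (M.rot * α).SameCycle x y) ↔ ∃ y ∈ T, M.SameVertex x y := by
  have iterates (f : Equiv.Perm H) : (∃ y ∈ T, f.SameCycle x y) ↔ ∃ k, f^[k] x ∈ T := by
    simp only [sameCycle_iff_exists_iterate]
    grind
  rw [iterates, exists_mem_iterate_iff hα']
  exact (iterates _).symm

theorem numFaces_submap (hroot : M.root ∈ T) (hT : ∀ x, M.edge x ∈ T ↔ x ∈ T)
    (hspan : ∀ x, ∃ y ∈ T, M.SameVertex x y) :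
    (M.submap T hroot hT).numFaces = numCycles (M.rot * α) := by
  have hface : (M.submap T hroot hT).rot * (M.submap T hroot hT).edge =
      (firstReturn (M.rot * α) fun x => x ∈ T).subtypePerm
        (fun x => iff_of_eq (firstReturn_class (M.rot * α) (fun x => x ∈ T) x)) := by
    ext ⟨x, hx⟩
    exact (firstReturn_mul_eq hα hα' hT hx).symm
  refine numCycles_eq_of_sameCycle_iff Subtype.val (fun x y => ?_) fun x => ?_
  · rw [hface, sameCycle_subtypePerm, sameCycle_firstReturn_iff]
    simp
  · obtain ⟨y, hy, hxy⟩ := (exists_mem_sameCycle_iff hα' x).2 (hspan x)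
    exact ⟨⟨y, hy⟩, hxy.symm⟩

end Restrict

theorem numVertices_submap {T : Set H} (hroot : M.root ∈ T) (hT : ∀ x, M.edge x ∈ T ↔ x ∈ T)
    (hspan : ∀ x, ∃ y ∈ T, M.SameVertex x y) :
    (M.submap T hroot hT).numVertices = M.numVertices := by
  refine numCycles_eq_of_sameCycle_iff Subtype.val (fun x y => ?_) fun x => ?_
  · rw [submap, sameCycle_subtypePerm, sameCycle_firstReturn_iff]
    simp
  · obtain ⟨y, hy, hxy⟩ := hspan x
    exact ⟨⟨y, hy⟩, hxy.symm⟩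

theorem isNonCrossingFactor_iff_two_mul_numVertices {T : Set H} {α : Equiv.Perm H}
    (hα : ∀ x ∈ T, α x = M.edge x) (hα' : ∀ x ∉ T, α x = x)
    (hedge : ∀ x, M.edge (M.edge x) = x) (hfix : ∀ x, M.edge x = x ↔ x = M.root)
    (hroot : M.root ∈ T) (hT : ∀ x, M.edge x ∈ T ↔ x ∈ T)
    (hcycle : ∀ x y, (M.rot * α).SameCycle x y) :
    IsNonCrossingFactor (M.rot * α) α ↔ 2 * M.numVertices = Nat.card T + 1 := by
  have : Nonempty H := ⟨M.root⟩
  have hrot : M.rot * α * α = M.rot := by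
    ext x
    by_cases hx : x ∈ T
    · simp [hα x hx, hα _ ((hT x).2 hx), hedge]
    · simp [hα' x hx]
  have := two_mul_numCycles_add_card hα hα' hedge hfix hroot hT
  have hV : M.numVertices = numCycles M.rot := rfl
  rw [isNonCrossingFactor_iff hcycle, hrot]
  omega

theorem IsTreeTour.isSpanningTree {T : Set H} {α : Equiv.Perm H} (h : M.IsTreeTour T α) :
    M.IsSpanningTree T := by
  have : Nonempty H := ⟨M.root⟩
  have hspan (x : H) : ∃ y ∈ T, M.SameVertex x y :=
    (exists_mem_sameCycle_iff h.apply_of_notMem x).1 ⟨_, h.root_mem, h.sameCycle _ _⟩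
  have hfaces := numFaces_submap h.apply_of_mem h.apply_of_notMem h.root_mem
    (fun x => h.edge_mem_iff) hspan
  rw [numCycles_eq_one_iff.2 h.sameCycle] at hfaces
  have : Nonempty T := ⟨_, h.root_mem⟩
  refine ⟨⟨h.root_mem, fun x => h.edge_mem_iff, isPlaneTree_iff.2 ⟨fun x => Subtype.ext
    (h.edge_edge x), fun x => ?_, numCycles_eq_one_iff.1 hfaces, ?_⟩⟩, hspan⟩
  · rw [Subtype.ext_iff, Subtype.ext_iff]
    exact h.edge_eq_self_iff x
  rw [numVertices_submap _ _ hspan]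
  exact (isNonCrossingFactor_iff_two_mul_numVertices h.apply_of_mem h.apply_of_notMem h.edge_edge
    h.edge_eq_self_iff h.root_mem (fun x => h.edge_mem_iff) h.sameCycle).1 h.isNonCrossingFactor

theorem IsSpanningTree.exists_isTreeTour {T : Set H} (h : M.IsSpanningTree T)
    (hM : M.IsRootedMap) : ∃ α, M.IsTreeTour T α := by
  classical
  have : Nonempty H := ⟨M.root⟩
  obtain ⟨⟨hroot, hT, htree⟩, hspan⟩ := h
  obtain ⟨-, -, hcycle, hvertices⟩ := isPlaneTree_iff.1 htree
  let α : Equiv.Perm H := ofSubtype (M.edge.subtypePerm hT)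
  have hα (x : H) (hx : x ∈ T) : α x = M.edge x := ofSubtype_apply_of_mem _ hx
  have hα' (x : H) (hx : x ∉ T) : α x = x := ofSubtype_apply_of_not_mem _ hx
  have : Nonempty T := ⟨_, hroot⟩
  have hfaces := numFaces_submap hα hα' hroot hT hspan
  have hone : (M.submap T hroot hT).numFaces = 1 := numCycles_eq_one_iff.2 hcycle
  rw [hone] at hfaces
  have hcycle := numCycles_eq_one_iff.1 hfaces.symm
  rw [numVertices_submap _ _ hspan] at hvertices
  exact ⟨α, hM.edge_edge, hM.edge_eq_self_iff, hroot, hα, hα', hcycle,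
    (isNonCrossingFactor_iff_two_mul_numVertices hα hα' hM.edge_edge hM.edge_eq_self_iff hroot hT
      hcycle).2 hvertices⟩

theorem isPlaneTree_iff_isTreeTour : M.IsPlaneTree ↔ M.IsTreeTour Set.univ M.edge := by
  have key := isNonCrossingFactor_iff_two_mul_numVertices (M := M) (T := Set.univ) (α := M.edge)
    (fun _ _ => rfl) (fun x hx => absurd trivial hx)
  simp only [Nat.card_univ] at key
  rw [isPlaneTree_iff]
  constructor
  · rintro ⟨hedge, hfix, hcycle, hvertices⟩
    exact ⟨hedge, hfix, trivial, fun _ _ => rfl, fun x hx => absurd trivial hx, hcycle,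
      (key hedge hfix trivial (by simp) hcycle).2 hvertices⟩
  · intro h
    exact ⟨h.edge_edge, h.edge_eq_self_iff, h.sameCycle,
      (key h.edge_edge h.edge_eq_self_iff trivial (by simp) h.sameCycle).1 h.isNonCrossingFactor⟩

end MapData

namespace MapData

variable {H : Type*} {M : MapData H}

section FirstHead

variable {O : Set H}

theorem firstHead_of_mem {x : H} (hx : x ∈ O) : M.firstHead O x = x := by
  classical
  have h : ∃ k : ℕ, M.rot^[k] x ∈ O := ⟨0, hx⟩
  rw [firstHead, dif_pos h, (Nat.find_eq_zero h).2 hx]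
  rfl

variable (hO : ∀ x, ∃ k : ℕ, M.rot^[k] x ∈ O)

include hO

theorem firstHead_mem (x : H) : M.firstHead O x ∈ O := by
  classical
  rw [firstHead, dif_pos (hO x)]
  exact Nat.find_spec (hO x)

theorem firstHead_rot {x : H} (hx : x ∉ O) : M.firstHead O (M.rot x) = M.firstHead O x := by
  classical
  rw [firstHead, dif_pos (hO _), firstHead, dif_pos (hO x)]
  have : Nat.find (hO x) = Nat.find (hO (M.rot x)) + 1 := Nat.find_comp_succ _ _ hx
  rw [this, Function.iterate_succ_apply]

theorem firstHead_induction {p : H → Prop} (mem : ∀ x ∈ O, p x)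
    (rot : ∀ x ∉ O, p (M.rot x) → p x) (x : H) : p x := by
  obtain ⟨k, hk⟩ := hO x
  induction k generalizing x with
  | zero => exact mem x hk
  | succ k ih =>
    by_cases hx : x ∈ O
    · exact mem x hx
    · exact rot x hx (ih (M.rot x) hk)

theorem sameVertex_firstHead (x : H) : M.SameVertex x (M.firstHead O x) := by
  induction x using firstHead_induction hO with
  | mem x hx =>
    rw [firstHead_of_mem hx]
    exact .refl _ _
  | rot x hx ih =>
    rw [← firstHead_rot hO hx]
    exact sameCycle_apply_left.1 ih

variable [Finite H]

theorem explosion_sameVertex_iff {x y : H} :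
    (M.explosion O).SameVertex x y ↔ M.firstHead O x = M.firstHead O y := by
  rw [SameVertex, explosion, sameCycle_firstReturn_iff, and_iff_right_iff_imp]
  intro h
  have hx := sameVertex_firstHead hO x
  rw [h] at hx
  exact hx.trans (sameVertex_firstHead hO y).symm

theorem explosion_rot_of_notMem {x : H} (hx : x ∉ O) : (M.explosion O).rot x = M.rot x :=
  firstReturn_eq_of_apply _ _ (firstHead_rot hO hx)

theorem explosion_sameVertex_firstHead (x : H) :
    (M.explosion O).SameVertex x (M.firstHead O x) :=
  (explosion_sameVertex_iff hO).2 (firstHead_of_mem (firstHead_mem hO x)).symm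

theorem numVertices_explosion : (M.explosion O).numVertices = O.ncard := by
  rw [← Nat.card_coe_set_eq]
  refine (Nat.card_congr (Equiv.ofBijective (fun h : O => Quotient.mk _ h.1) ⟨?_, ?_⟩)).symm
  · intro g h hgh
    have := (explosion_sameVertex_iff hO).1 (Quotient.exact hgh)
    rw [firstHead_of_mem g.2, firstHead_of_mem h.2] at this
    exact Subtype.ext this
  · rintro ⟨x⟩
    exact ⟨⟨_, firstHead_mem hO x⟩, Quotient.sound (explosion_sameVertex_firstHead hO x).symm⟩

end FirstHead

/-- The rank of a half-edge in the tour `M.rot * α`, in which the root comes last. -/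
noncomputable def headRank (M : MapData H) (α : Equiv.Perm H) (x : H) : ℕ :=
  cyclicDist (M.rot * α) ((M.rot * α) M.root) x

namespace IsTreeTour

variable [Finite H] {T : Set H} {α : Equiv.Perm H}

theorem headRank_add_one (h : M.IsTreeTour T α) {x : H} (hx : x ≠ M.root) :
    M.headRank α x + 1 = M.tourTime α x := by
  have hpos := h.tourTime_pos hx
  have hlt := h.tourTime_lt_card x
  obtain ⟨k, hk⟩ := Nat.exists_eq_succ_of_ne_zero hpos.ne'
  have hx := iterate_cyclicDist h.sameCycle M.root x
  rw [← tourTime, hk, Function.iterate_succ_apply] at hx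
  rw [headRank, hk, ← hx, cyclicDist_iterate_of_lt h.sameCycle _ (by omega)]

theorem headRank_lt_iff (h : M.IsTreeTour T α) {x y : H} (hx : x ≠ M.root) (hy : y ≠ M.root) :
    M.headRank α x < M.headRank α y ↔ M.tourTime α x < M.tourTime α y := by
  rw [← h.headRank_add_one hx, ← h.headRank_add_one hy, Nat.add_lt_add_iff_right]

theorem headRank_mul_apply (h : M.IsTreeTour T α) {x : H} (hx : x ≠ M.root) :
    M.headRank α ((M.rot * α) x) = M.headRank α x + 1 :=
  cyclicDist_apply h.sameCycle ((M.rot * α).injective.ne hx)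

theorem ne_root_of_notMem_treeHeads (h : M.IsTreeTour T α) {x : H} (hx : x ∉ M.treeHeads T) :
    x ≠ M.root := fun heq => hx (heq ▸ h.root_mem_treeHeads)

theorem edge_mem_treeHeads_of_notMem (h : M.IsTreeTour T α) {x : H} (hx : x ∉ M.treeHeads T) :
    M.edge x ∈ M.treeHeads T :=
  (h.edge_mem_treeHeads_iff (h.ne_root_of_notMem_treeHeads hx)).2 hx

theorem headRank_lt_rot (h : M.IsTreeTour T α) {x : H} (hx : x ∉ M.treeHeads T) :
    M.headRank α x < M.headRank α (M.rot x) := by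
  have hroot := h.ne_root_of_notMem_treeHeads hx
  by_cases hxT : x ∈ T
  · have hlt : M.headRank α x < M.headRank α (M.edge x) := by
      rw [h.headRank_lt_iff hroot (h.edge_ne_root hroot)]
      have := h.tourTime_edge_ne hroot
      have := h.mem_tree_iff.1 hxT
      grind
    have := h.headRank_mul_apply (h.edge_ne_root hroot)
    rw [h.mul_apply_of_mem (h.edge_mem hxT), h.edge_edge] at this
    omega
  · have := h.headRank_mul_apply hroot
    rw [h.mul_apply_of_notMem hxT] at this
    omega

theorem exists_iterate_mem_treeHeads (h : M.IsTreeTour T α) (x : H) :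
    ∃ k, M.rot^[k] x ∈ M.treeHeads T := by
  by_contra! hnot
  have le_headRank (k : ℕ) : k ≤ M.headRank α (M.rot^[k] x) := by
    induction k with
    | zero => exact Nat.zero_le _
    | succ k ih =>
      rw [Function.iterate_succ_apply']
      exact ih.trans_lt (h.headRank_lt_rot (hnot k))
  exact (le_headRank _).not_gt (cyclicDist_lt_card h.sameCycle _ _)

theorem headRank_le_firstHead (h : M.IsTreeTour T α) (x : H) :
    M.headRank α x ≤ M.headRank α (M.firstHead (M.treeHeads T) x) := by
  induction x using firstHead_induction h.exists_iterate_mem_treeHeads with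
  | mem x hx => rw [firstHead_of_mem hx]
  | rot x hx ih =>
    rw [← firstHead_rot h.exists_iterate_mem_treeHeads hx]
    exact (h.headRank_lt_rot hx).le.trans ih

theorem headRank_lt_firstHead_edge (h : M.IsTreeTour T α) {x : H} (hx : x ∈ M.treeHeads T)
    (hroot : x ≠ M.root) :
    M.headRank α x < M.headRank α (M.firstHead (M.treeHeads T) (M.edge x)) := by
  by_cases hxT : x ∈ T
  · have htail : M.edge x ∉ M.treeHeads T := fun hmem =>
      (h.edge_mem_treeHeads_iff hroot).1 hmem hx
    rw [← firstHead_rot h.exists_iterate_mem_treeHeads htail, ← h.mul_apply_of_mem hxT]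
    refine lt_of_lt_of_le ?_ (h.headRank_le_firstHead _)
    rw [h.headRank_mul_apply hroot]
    exact Nat.lt_succ_self _
  · have hlt := (h.mem_treeHeads_iff.1 hx).resolve_left hroot
    refine lt_of_lt_of_le ?_ (h.headRank_le_firstHead _)
    rw [h.headRank_lt_iff hroot (h.edge_ne_root hroot)]
    grind

theorem headRank_edge_lt_firstHead (h : M.IsTreeTour T α) {x : H} (hx : x ∉ M.treeHeads T) :
    M.headRank α (M.edge x) < M.headRank α (M.firstHead (M.treeHeads T) x) := by
  simpa only [h.edge_edge] using h.headRank_lt_firstHead_edge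
    (h.edge_mem_treeHeads_of_notMem hx) (h.edge_ne_root (h.ne_root_of_notMem_treeHeads hx))

theorem two_mul_ncard_treeHeads (h : M.IsTreeTour T α) :
    2 * (M.treeHeads T).ncard = Nat.card H + 1 := by
  have hheads : M.treeHeads T = insert M.root (M.edge '' (M.treeHeads T)ᶜ) := by
    ext x
    by_cases hx : x = M.root
    · simp [hx, h.root_mem_treeHeads]
    · rw [Set.mem_insert_iff, or_iff_right hx, M.edge.image_eq_preimage_symm]
      have : M.edge.symm x = M.edge x := by rw [Equiv.symm_apply_eq, h.edge_edge]
      rw [Set.mem_preimage, this, Set.mem_compl_iff, h.edge_mem_treeHeads_iff hx, not_not]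
  have hroot : M.root ∉ M.edge '' (M.treeHeads T)ᶜ := by
    rintro ⟨x, hx, hxroot⟩
    exact h.edge_ne_root (h.ne_root_of_notMem_treeHeads hx) hxroot
  have hcard := congrArg Set.ncard hheads
  rw [Set.ncard_insert_of_notMem hroot, Set.ncard_image_of_injective _ M.edge.injective] at hcard
  have := Set.ncard_add_ncard_compl (M.treeHeads T)
  omega

end IsTreeTour

end MapData

namespace MapData

variable {H : Type*} [Finite H] {M : MapData H}

namespace IsTreeTour

variable {T : Set H} {α : Equiv.Perm H}

/-- The head at the other end of a tail incident to the exploded vertex of `x` has a smaller rank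
than `x`, which allows for an induction on the rank. -/
theorem explosion_sameCycle_edge (h : M.IsTreeTour T α) (x : H) :
    ((M.explosion (M.treeHeads T)).rot * M.edge).SameCycle x (M.edge x) := by
  set O := M.treeHeads T
  set P := M.explosion O
  set σ := P.rot * M.edge
  have hO := h.exists_iterate_mem_treeHeads
  have σ_edge (y : H) : σ (M.edge y) = P.rot y := by simp [σ, h.edge_edge]
  have of_mem (x : H) (hx : x ∈ O) : σ.SameCycle (M.edge x) x := by
    induction hr : M.headRank α x using Nat.strong_induction_on generalizing x with
    | _ r ih =>
    by_cases hroot : x = M.root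
    · rw [hroot, h.edge_root]
    have tail (y : H) (hy : M.firstHead O y = x) (hyO : y ∉ O) : σ.SameCycle (M.edge y) y := by
      have hlt := hr ▸ hy ▸ h.headRank_edge_lt_firstHead hyO
      have := ih _ hlt (M.edge y) (h.edge_mem_treeHeads_of_notMem hyO) rfl
      rwa [h.edge_edge, sameCycle_comm] at this
    by_contra hnot
    have closed (y : H) (hy : P.SameVertex x y ∧ σ.SameCycle (M.edge x) y) :
        P.SameVertex x (P.rot y) ∧ σ.SameCycle (M.edge x) (P.rot y) := by
      refine ⟨sameCycle_apply_right.2 hy.1, ?_⟩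
      rw [← σ_edge, sameCycle_apply_right]
      have hhead := (explosion_sameVertex_iff hO).1 hy.1
      rw [firstHead_of_mem hx] at hhead
      have hyO : y ∉ O := fun hyO => hnot (by
        rw [firstHead_of_mem hyO] at hhead
        exact hhead ▸ hy.2)
      exact hy.2.trans (tail y hhead.symm hyO).symm
    have hrot : P.SameVertex x (P.rot x) ∧ σ.SameCycle (M.edge x) (P.rot x) :=
      ⟨sameCycle_apply_right.2 (.refl _ _), σ_edge x ▸ sameCycle_apply_right.2 (.refl _ _)⟩
    exact hnot ((mem_iff_of_sameCycle (f := P.rot)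
      (s := {y | P.SameVertex x y ∧ σ.SameCycle (M.edge x) y}) closed
      (sameCycle_apply_left.2 (.refl _ x))).1 hrot).2
  by_cases hx : x ∈ O
  · exact (of_mem x hx).symm
  · simpa only [h.edge_edge] using of_mem _ (h.edge_mem_treeHeads_of_notMem hx)

theorem explosion_sameCycle (h : M.IsTreeTour T α) (x y : H) :
    ((M.explosion (M.treeHeads T)).rot * M.edge).SameCycle x y := by
  set O := M.treeHeads T
  set P := M.explosion O
  set σ := P.rot * M.edge
  have hO := h.exists_iterate_mem_treeHeads
  have of_sameVertex {x y : H} (hxy : P.SameVertex x y) : σ.SameCycle x y := by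
    refine (mem_iff_of_sameCycle (s := {y | σ.SameCycle x y}) (fun y hy => ?_) hxy).1 (.refl _ _)
    have hy : σ.SameCycle x (M.edge y) := hy.trans (h.explosion_sameCycle_edge y)
    have hσ : σ (M.edge y) = P.rot y := by simp [σ, h.edge_edge]
    exact hσ ▸ sameCycle_apply_right.2 hy
  have to_firstHead (x : H) : σ.SameCycle x (M.firstHead O x) :=
    of_sameVertex (explosion_sameVertex_firstHead hO x)
  have head_to_root (x : H) (hx : x ∈ O) : σ.SameCycle x M.root := by
    induction hr : Nat.card H - M.headRank α x using Nat.strong_induction_on generalizing x with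
    | _ r ih =>
    by_cases hroot : x = M.root
    · rw [hroot]
    refine (h.explosion_sameCycle_edge x).trans ((to_firstHead _).trans
      (ih _ ?_ _ (firstHead_mem hO _) rfl))
    have : M.headRank α x < M.headRank α (M.firstHead O (M.edge x)) :=
      h.headRank_lt_firstHead_edge hx hroot
    have : M.headRank α (M.firstHead O (M.edge x)) < Nat.card H :=
      cyclicDist_lt_card h.sameCycle _ _
    omega
  have to_root (x : H) : σ.SameCycle x M.root :=
    (to_firstHead x).trans (head_to_root _ (firstHead_mem hO x))
  exact (to_root x).trans (to_root y).symm

theorem isPlaneTree_explosion (h : M.IsTreeTour T α) :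
    (M.explosion (M.treeHeads T)).IsPlaneTree := by
  refine isPlaneTree_iff.2 ⟨h.edge_edge, h.edge_eq_self_iff, h.explosion_sameCycle, ?_⟩
  rw [numVertices_explosion h.exists_iterate_mem_treeHeads, h.two_mul_ncard_treeHeads]

theorem explosion (h : M.IsTreeTour T α) :
    (M.explosion (M.treeHeads T)).IsTreeTour Set.univ M.edge :=
  isPlaneTree_iff_isTreeTour.1 h.isPlaneTree_explosion

theorem treeHeads_explosion (h : M.IsTreeTour T α) :
    (M.explosion (M.treeHeads T)).treeHeads Set.univ = M.treeHeads T := by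
  set O := M.treeHeads T
  set P := M.explosion O
  have hO := h.exists_iterate_mem_treeHeads
  have hP : P.IsTreeTour Set.univ M.edge := h.explosion
  have mem (x : H) (hx : x ∈ O) : x ∈ P.treeHeads Set.univ := by
    induction hr : M.headRank α x using Nat.strong_induction_on generalizing x with
    | _ r ih =>
    obtain ⟨k, hk⟩ := hP.exists_iterate_mem_treeHeads x
    set y := P.rot^[k] x
    have hxy : P.SameVertex x y := sameCycle_iff_exists_iterate.2 ⟨k, rfl⟩
    have hhead := (explosion_sameVertex_iff hO).1 hxy
    rw [firstHead_of_mem hx] at hhead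
    by_cases hy : y ∈ O
    · rwa [hhead, firstHead_of_mem hy]
    have hlt := hr ▸ hhead ▸ h.headRank_edge_lt_firstHead hy
    have hmem := ih _ hlt _ (h.edge_mem_treeHeads_of_notMem hy) rfl
    exact absurd hk ((hP.edge_mem_treeHeads_iff (h.ne_root_of_notMem_treeHeads hy)).1 hmem)
  refine Set.Subset.antisymm (fun x hx => ?_) mem
  by_contra hxO
  exact (hP.edge_mem_treeHeads_iff (h.ne_root_of_notMem_treeHeads hxO)).1
    (mem _ (h.edge_mem_treeHeads_of_notMem hxO)) hx

end IsTreeTour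

section HeadPerm

/-- The permutation of the heads that merges the vertices of the exploded map into those of `M`.
Its cycles on `O` are the vertices of `M`, and it fixes the tails. -/
noncomputable def headPerm (M : MapData H) (O : Set H) : Equiv.Perm H :=
  (M.explosion O).rot⁻¹ * M.rot

variable {O : Set H}

theorem explosion_rot_headPerm (x : H) : (M.explosion O).rot (M.headPerm O x) = M.rot x := by
  simp [headPerm]

variable (hO : ∀ x, ∃ k : ℕ, M.rot^[k] x ∈ O)

include hO

theorem headPerm_of_notMem {x : H} (hx : x ∉ O) : M.headPerm O x = x :=
  (M.explosion O).rot.injective (by rw [explosion_rot_headPerm, explosion_rot_of_notMem hO hx])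

theorem headPerm_mem {x : H} (hx : x ∈ O) : M.headPerm O x ∈ O := by
  by_contra hnot
  exact hnot (((M.headPerm O).injective (headPerm_of_notMem hO hnot)).symm ▸ hx)

theorem headPerm_sameCycle_firstHead_iff {x y : H} :
    (M.headPerm O).SameCycle (M.firstHead O x) (M.firstHead O y) ↔ M.SameVertex x y := by
  constructor
  · intro h
    refine (sameVertex_firstHead hO x).trans (SameCycle.trans ?_ (sameVertex_firstHead hO y).symm)
    refine (mem_iff_of_sameCycle (s := {z | M.SameVertex (M.firstHead O x) z})
      (fun z hz => ?_) h).1 (.refl _ _)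
    have hrot : (M.explosion O).SameVertex (M.headPerm O z) (M.rot z) := by
      rw [← explosion_rot_headPerm]
      exact sameCycle_apply_right.2 (.refl _ _)
    have : M.SameVertex z (M.rot z) := sameCycle_apply_right.2 (.refl _ _)
    exact (hz.trans this).trans (sameCycle_firstReturn_iff M.rot _ |>.1 hrot).1.symm
  · refine fun h => (mem_iff_of_sameCycle
      (s := {z | (M.headPerm O).SameCycle (M.firstHead O x) (M.firstHead O z)})
      (fun z hz => ?_) h).1 (.refl _ _)
    by_cases hzO : z ∈ O
    · have hvertex : (M.explosion O).SameVertex (M.rot z) (M.headPerm O z) := by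
        rw [← explosion_rot_headPerm]
        exact sameCycle_apply_left.2 (.refl _ _)
      have hhead := (explosion_sameVertex_iff hO).1 hvertex
      rw [firstHead_of_mem (headPerm_mem hO hzO)] at hhead
      rw [Set.mem_ofPred, firstHead_of_mem hzO] at hz
      rw [Set.mem_ofPred, hhead]
      exact sameCycle_apply_right.2 hz
    · rwa [Set.mem_ofPred, firstHead_rot hO hzO]

theorem numCycles_headPerm : numCycles (M.headPerm O) = M.numVertices + Oᶜ.ncard := by
  let s : Setoid H := SameCycle.setoid M.rot
  let s' : Setoid H := SameCycle.setoid (M.headPerm O)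
  let vertex : Quotient s → Quotient s' := Quotient.map (M.firstHead O)
    fun x y h => (headPerm_sameCycle_firstHead_iff hO).2 h
  let tail : (Oᶜ : Set H) → Quotient s' := fun t => Quotient.mk s' t
  have eq_of_tail (t : (Oᶜ : Set H)) (x : H) (h : Quotient.mk s' x = tail t) : x = t :=
    ((Quotient.exact h).symm.eq_of_left (headPerm_of_notMem hO t.2)).symm
  have hvertex : Function.Injective vertex := by
    rintro ⟨x⟩ ⟨y⟩ h
    exact Quotient.sound ((headPerm_sameCycle_firstHead_iff hO).1 (Quotient.exact h))
  have htail : Function.Injective tail := fun t u h => Subtype.ext (eq_of_tail u t h)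
  have hne (q : Quotient s) (t : (Oᶜ : Set H)) : vertex q ≠ tail t := by
    induction q using Quotient.inductionOn with
    | h x => exact fun h => t.2 (eq_of_tail t _ h ▸ firstHead_mem hO x)
  have hsurj : Function.Surjective (Sum.elim vertex tail) := by
    rintro ⟨x⟩
    by_cases hx : x ∈ O
    · exact ⟨.inl (Quotient.mk s x), congrArg (Quotient.mk s') (firstHead_of_mem hx)⟩
    · exact ⟨.inr ⟨x, hx⟩, rfl⟩
  rw [← Nat.card_coe_set_eq, numVertices, ← Nat.card_sum]
  exact (Nat.card_congr (.ofBijective _ ⟨hvertex.sumElim htail hne, hsurj⟩)).symm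

end HeadPerm

/-- By Euler's formula. -/
theorem IsTreeTour.isNonCrossingFactor_headPerm {T : Set H} {α : Equiv.Perm H}
    (h : M.IsTreeTour T α) (hM : M.IsRootedMap) :
    IsNonCrossingFactor ((M.explosion (M.treeHeads T)).rot * M.edge)
      (M.edge * M.headPerm (M.treeHeads T) * M.edge⁻¹) := by
  have : Nonempty H := ⟨M.root⟩
  have hedge : M.edge⁻¹ = M.edge := by
    ext x
    rw [inv_eq_iff_eq, h.edge_edge]
  have hfaces : (M.explosion (M.treeHeads T)).rot * M.edge *
      (M.edge * M.headPerm (M.treeHeads T) * M.edge⁻¹) = M.rot * M.edge := by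
    ext x
    simp [hedge, h.edge_edge, explosion_rot_headPerm]
  rw [isNonCrossingFactor_iff h.explosion_sameCycle, numCycles_conj, hfaces,
    numCycles_headPerm h.exists_iterate_mem_treeHeads]
  have := hM.euler
  have := two_mul_numEdges_add_one h.edge_edge h.edge_eq_self_iff
  have := h.two_mul_ncard_treeHeads
  have := Set.ncard_add_ncard_compl (M.treeHeads T)
  have hF : M.numFaces = numCycles (M.rot * M.edge) := rfl
  omega

end MapData

namespace MapData

variable {H : Type*} [Finite H] {M : MapData H}

omit [Finite H] in
theorem exists_isDiscoveryTime {k : ℕ} :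
    ∃ j ≤ k, M.IsDiscoveryTime j ∧ M.SameVertex (M.tour Set.univ j) (M.tour Set.univ k) := by
  classical
  have h : ∃ j, M.SameVertex (M.tour Set.univ j) (M.tour Set.univ k) := ⟨k, .refl _ _⟩
  exact ⟨Nat.find h, Nat.find_min' h (.refl _ _),
    fun i hi hv => Nat.find_min h hi (hv.trans (Nat.find_spec h)), Nat.find_spec h⟩

namespace IsTreeTour

variable {α : Equiv.Perm H} (h : M.IsTreeTour Set.univ α)

include h

theorem tourTime_edge_lt_of_mem_treeHeads {x y : H} (hx : x ∈ M.treeHeads Set.univ)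
    (hroot : x ≠ M.root) (hxy : M.SameVertex x y) : M.tourTime α (M.edge x) < M.tourTime α y := by
  have hlt : M.tourTime α (M.edge x) < M.tourTime α (M.edge (M.edge x)) := by
    rw [h.edge_edge]
    have := h.mem_treeHeads_iff.1 hx
    simp_all
  have hbetween := h.sameVertex_between_iff (x := M.edge x) trivial hlt hxy
  rw [h.edge_edge] at hbetween hlt
  exact (hbetween.1 ⟨hlt, le_rfl⟩).1

/-- A vertex other than the root-vertex is discovered when the tour crosses the edge of its head. -/
theorem eq_tourTime_edge_add_one {x : H} {k : ℕ} (hx : x ∈ M.treeHeads Set.univ)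
    (hroot : x ≠ M.root) (hk : M.IsDiscoveryTime k) (hxk : M.SameVertex x (M.tour Set.univ k)) :
    k = M.tourTime α (M.edge x) + 1 := by
  have hfirst {j : ℕ} (hxj : M.SameVertex x (M.tour Set.univ j)) : k ≤ j :=
    not_lt.1 fun hjk => hk j hjk (hxj.symm.trans hxk)
  have hle : k ≤ M.tourTime α (M.tour Set.univ k) := hfirst (by rwa [h.tour_tourTime])
  have hlt := h.tourTime_edge_lt_of_mem_treeHeads hx hroot hxk
  rw [h.tourTime_tour (hle.trans_lt (h.tourTime_lt_card _))] at hlt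
  refine (hfirst ?_).antisymm hlt
  have hnext : M.tour Set.univ (M.tourTime α (M.edge x) + 1) = M.rot x := by
    have := h.mul_apply_of_mem (x := M.edge x) trivial
    rw [h.tour_eq_iterate, Function.iterate_succ_apply', ← h.tour_eq_iterate, h.tour_tourTime,
      this, h.edge_edge]
  rw [hnext]
  exact sameCycle_apply_right.2 (.refl _ _)

theorem tourTime_edge_lt_of_isDiscoveryTime {x y : H} {j k : ℕ} (hjk : j < k)
    (hx : x ∈ M.treeHeads Set.univ) (hy : y ∈ M.treeHeads Set.univ)
    (hj : M.IsDiscoveryTime j) (hk : M.IsDiscoveryTime k)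
    (hxj : M.SameVertex x (M.tour Set.univ j)) (hyk : M.SameVertex y (M.tour Set.univ k)) :
    M.tourTime α (M.edge x) < M.tourTime α (M.edge y) := by
  have hyroot : y ≠ M.root := fun hyroot => hk 0 (by omega) (by rwa [hyroot] at hyk)
  have htime := h.eq_tourTime_edge_add_one hy hyroot hk hyk
  by_cases hxroot : x = M.root
  · rw [hxroot, h.edge_root, h.tourTime_root]
    exact h.tourTime_pos (h.edge_ne_root hyroot)
  · have := h.eq_tourTime_edge_add_one hx hxroot hj hxj
    omega

theorem ncard_isDiscoveryTime : (Set.ofPred M.IsDiscoveryTime).ncard = M.numVertices := by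
  rw [← Nat.card_coe_set_eq, numVertices]
  refine Nat.card_congr (.ofBijective
    (fun k : Set.ofPred M.IsDiscoveryTime => Quotient.mk _ (M.tour Set.univ k)) ⟨?_, ?_⟩)
  · rintro ⟨j, hj⟩ ⟨k, hk⟩ hjk
    have hjk : M.SameVertex _ _ := Quotient.exact hjk
    rcases lt_trichotomy j k with hlt | rfl | hlt
    · exact absurd hjk (hk j hlt)
    · rfl
    · exact absurd hjk.symm (hj k hlt)
  · rintro ⟨x⟩
    obtain ⟨j, -, hj, hjx⟩ := exists_isDiscoveryTime (M := M) (k := M.tourTime α x)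
    rw [h.tour_tourTime] at hjx
    exact ⟨⟨j, hj⟩, Quotient.sound hjx⟩

theorem lt_card_isDiscoveryTime {i : ℕ} (hi : i < M.numVertices)
    (hf : (Set.ofPred M.IsDiscoveryTime).Finite) : i < hf.toFinset.card := by
  rwa [← Set.ncard_eq_toFinset_card _ hf, h.ncard_isDiscoveryTime]

theorem tourTime_edge_lt_of_nthVertex {x y : H} {i j : ℕ} (hij : i < j) (hj : j < M.numVertices)
    (hx : x ∈ M.treeHeads Set.univ) (hy : y ∈ M.treeHeads Set.univ)
    (hxi : M.SameVertex x (M.nthVertex i)) (hyj : M.SameVertex y (M.nthVertex j)) :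
    M.tourTime α (M.edge x) < M.tourTime α (M.edge y) :=
  h.tourTime_edge_lt_of_isDiscoveryTime (Nat.nth_lt_nth' hij (h.lt_card_isDiscoveryTime hj)) hx hy
    (Nat.nth_mem i (h.lt_card_isDiscoveryTime (hij.trans hj)))
    (Nat.nth_mem j (h.lt_card_isDiscoveryTime hj)) hxi hyj

theorem exists_sameVertex_nthVertex (x : H) :
    ∃ i < M.numVertices, M.SameVertex x (M.nthVertex i) := by
  obtain ⟨k, -, hk, hkx⟩ := exists_isDiscoveryTime (M := M) (k := M.tourTime α x)
  rw [h.tour_tourTime] at hkx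
  have hcard := h.ncard_isDiscoveryTime
  have hfinite : (Set.ofPred M.IsDiscoveryTime).Finite := Set.finite_of_ncard_pos <| hcard ▸
    Nat.card_pos_iff.2 ⟨⟨Quotient.mk _ M.root⟩, inferInstance⟩
  obtain ⟨i, hi, rfl⟩ := Nat.exists_lt_card_nth_eq hk
  have := hi hfinite
  rw [← Set.ncard_eq_toFinset_card _ hfinite, hcard] at this
  exact ⟨i, this, hkx.symm⟩

end IsTreeTour

theorem explosionRel_iff {O : Set H} {m : ℕ} {i j : Fin m} : M.explosionRel O m i j ↔
    M.SameVertex ((M.explosion O).nthVertex i) ((M.explosion O).nthVertex j) := Iff.rfl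

theorem IsTreeTour.isNonCrossing_explosionRel {T : Set H} {α : Equiv.Perm H}
    (h : M.IsTreeTour T α) (hM : M.IsRootedMap) {m : ℕ}
    (hm : m ≤ (M.explosion (M.treeHeads T)).numVertices) :
    IsNonCrossing (M.explosionRel (M.treeHeads T) m) := by
  set O := M.treeHeads T
  set P := M.explosion O
  have hO := h.exists_iterate_mem_treeHeads
  have hP : P.IsTreeTour Set.univ M.edge := h.explosion
  let β : Equiv.Perm H := M.edge * M.headPerm O * M.edge⁻¹
  let point (i : Fin m) : H := M.edge (M.firstHead O (P.nthVertex i))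
  have point_lt {i j : Fin m} (hij : i < j) :
      P.tourTime M.edge (point i) < P.tourTime M.edge (point j) :=
    hP.tourTime_edge_lt_of_nthVertex hij (j.2.trans_le hm)
      (h.treeHeads_explosion ▸ firstHead_mem hO _) (h.treeHeads_explosion ▸ firstHead_mem hO _)
      (explosion_sameVertex_firstHead hO _).symm (explosion_sameVertex_firstHead hO _).symm
  have rel_iff {i j : Fin m} : M.explosionRel O m i j ↔ β.SameCycle (point i) (point j) := by
    rw [explosionRel_iff, ← headPerm_sameCycle_firstHead_iff hO, sameCycle_conj]
    simp [point, P, O]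
  intro a b c d hab hbc hcd hac hbd
  rw [rel_iff] at hac hbd ⊢
  exact (h.isNonCrossingFactor_headPerm hM).sameCycle_of_lt_of_lt hP.sameCycle
    (point_lt hab) (point_lt hbc) (point_lt hcd) hac hbd

end MapData

theorem firstReturn_conj {H H' ι ι' : Type*} [Finite H] [Finite H'] {f : Equiv.Perm H}
    {g : Equiv.Perm H'} {p : H → ι} {q : H' → ι'} {e : H ≃ H'} (hfg : ∀ x, e (f x) = g (e x))
    (hpq : ∀ x y, q (e x) = q (e y) ↔ p x = p y) (x : H) :
    e (firstReturn f p x) = firstReturn g q (e x) := by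
  obtain ⟨hpos, hreturn⟩ := firstReturnTime_spec f p x
  rw [firstReturn_apply, iterate_conj hfg]
  refine (firstReturn_eq_iterate g q hpos ?_ fun j hj hlt heq => hlt.not_ge ?_).symm
  · rw [← iterate_conj hfg, hpq, hreturn]
  · rw [← iterate_conj hfg, hpq] at heq
    exact firstReturnTime_le f p x hj heq

namespace MapData

variable {H H' : Type*} {M : MapData H} {N : MapData H'} {e : H ≃ H'}

namespace IsIso

variable (h : M.IsIso N e)

include h

theorem sameVertex_iff [Finite H] [Finite H'] {x y : H} :
    N.SameVertex (e x) (e y) ↔ M.SameVertex x y := by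
  rw [SameVertex, SameVertex, sameCycle_iff_exists_iterate, sameCycle_iff_exists_iterate]
  simp only [← iterate_conj h.rot, e.apply_eq_iff_eq]

theorem joined {S : Set H} {S' : Set H'} (hS : ∀ x ∈ S, e x ∈ S') {x y : H}
    (hxy : M.Joined S x y) : N.Joined S' (e x) (e y) := by
  induction hxy with
  | rel x y hxy =>
    rcases hxy with rfl | ⟨hx, rfl⟩
    · exact .rel _ _ (.inl (h.rot x))
    · exact .rel _ _ (.inr ⟨hS x hx, h.edge x⟩)
  | refl => exact .refl _
  | symm _ _ _ ih => exact ih.symm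
  | trans _ _ _ _ _ ih₁ ih₂ => exact ih₁.trans _ _ _ ih₂

theorem joined_iff {S : Set H} {S' : Set H'} (hS : ∀ x, e x ∈ S' ↔ x ∈ S) {x y : H} :
    N.Joined S' (e x) (e y) ↔ M.Joined S x y := by
  refine ⟨fun hj => ?_, h.joined fun x => (hS x).2⟩
  simpa using h.symm.joined (S' := S) (fun x hx => by rwa [← hS, e.apply_symm_apply]) hj

section Subset

variable {T : Set H} {T' : Set H'} (hT : ∀ x, e x ∈ T' ↔ x ∈ T)

include hT

theorem tourStep (x : H) : e (M.tourStep T x) = N.tourStep T' (e x) := by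
  by_cases hx : x ∈ T
  · simp [MapData.tourStep, hx, hT, h.rot, h.edge]
  · simp [MapData.tourStep, hx, hT, h.rot]

theorem tour (k : ℕ) : e (M.tour T k) = N.tour T' k := by
  rw [MapData.tour, MapData.tour, ← h.root]
  exact iterate_conj (h.tourStep hT) k _

theorem precedes_iff {x y : H} : N.Precedes T' (e x) (e y) ↔ M.Precedes T x y := by
  simp only [Precedes, ← h.tour hT, ne_eq, e.apply_eq_iff_eq]

theorem mem_treeHeads_iff (x : H) : e x ∈ N.treeHeads T' ↔ x ∈ M.treeHeads T := by
  simp only [treeHeads, Set.mem_ofPred_eq, ← h.root, e.apply_eq_iff_eq, hT, ← h.edge,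
    h.precedes_iff hT]
  rw [h.joined_iff (S := T \ {x, M.edge x})]
  intro y
  simp [hT]

theorem firstHead (x : H) : e (M.firstHead T x) = N.firstHead T' (e x) := by
  classical
  simp only [MapData.firstHead, ← iterate_conj h.rot, hT]
  split_ifs <;> rfl

theorem explosion [Finite H] [Finite H'] : (M.explosion T).IsIso (N.explosion T') e where
  rot := firstReturn_conj h.rot fun x y => by
    rw [← h.firstHead hT, ← h.firstHead hT, e.apply_eq_iff_eq]
  edge := h.edge
  root := h.root

end Subset

theorem nthVertex [Finite H] [Finite H'] (i : ℕ) : e (M.nthVertex i) = N.nthVertex i := by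
  have htour (k : ℕ) : e (M.tour Set.univ k) = N.tour Set.univ k := h.tour (by simp) k
  have hdiscovery : N.IsDiscoveryTime = M.IsDiscoveryTime := by
    funext k
    simp only [IsDiscoveryTime, ← htour, h.sameVertex_iff]
  rw [MapData.nthVertex, MapData.nthVertex, htour, hdiscovery]

theorem explosionRel_eq [Finite H] [Finite H'] {O : Set H} {O' : Set H'}
    (hO : ∀ x, e x ∈ O' ↔ x ∈ O) (m : ℕ) : N.explosionRel O' m = M.explosionRel O m := by
  ext i j
  rw [explosionRel_iff, explosionRel_iff, ← h.sameVertex_iff, (h.explosion hO).nthVertex,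
    (h.explosion hO).nthVertex]

end IsIso

theorem sameVertex_congr {x x' y y' : H} (hx : M.SameVertex x x') (hy : M.SameVertex y y') :
    M.SameVertex x y ↔ M.SameVertex x' y' :=
  ⟨fun hxy => (hx.symm.trans hxy).trans hy, fun hxy => (hx.trans hxy).trans hy.symm⟩

theorem sameVertex_of_explosion [Finite H] {O : Set H} {x y : H}
    (hxy : (M.explosion O).SameVertex x y) : M.SameVertex x y :=
  ((sameCycle_firstReturn_iff _ _).1 hxy).1

theorem headPerm_sameCycle_iff [Finite H] {O : Set H} (hO : ∀ x, ∃ k : ℕ, M.rot^[k] x ∈ O)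
    {x y : H} :
    (M.headPerm O).SameCycle x y ↔ x = y ∨ x ∈ O ∧ y ∈ O ∧ M.SameVertex x y := by
  by_cases hx : x ∈ O
  · by_cases hy : y ∈ O
    · rw [← headPerm_sameCycle_firstHead_iff hO, firstHead_of_mem hx, firstHead_of_mem hy]
      refine ⟨fun h => .inr ⟨hx, hy, h⟩, ?_⟩
      rintro (rfl | h)
      exacts [.refl _ _, h.2.2]
    · simp only [hy, false_and, and_false, or_false]
      exact ⟨fun h => h.eq_of_right (headPerm_of_notMem hO hy), fun h => h ▸ .refl _ _⟩
  · simp only [hx, false_and, or_false]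
    exact ⟨fun h => h.eq_of_left (headPerm_of_notMem hO hx), fun h => h ▸ .refl _ _⟩

namespace IsTreeTour

variable [Finite H] [Finite H'] {T : Set H} {T' : Set H'} {α : Equiv.Perm H} {α' : Equiv.Perm H'}

theorem sameVertex_iff_of_explosionRel_eq (h : M.IsTreeTour T α)
    (he : (M.explosion (M.treeHeads T)).IsIso (N.explosion (N.treeHeads T')) e)
    (hrel : M.explosionRel (M.treeHeads T) (M.explosion (M.treeHeads T)).numVertices =
      N.explosionRel (N.treeHeads T') (M.explosion (M.treeHeads T)).numVertices) (x y : H) :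
    N.SameVertex (e x) (e y) ↔ M.SameVertex x y := by
  obtain ⟨i, hi, hxi⟩ := h.explosion.exists_sameVertex_nthVertex x
  obtain ⟨j, hj, hyj⟩ := h.explosion.exists_sameVertex_nthVertex y
  rw [sameVertex_congr (sameVertex_of_explosion hxi) (sameVertex_of_explosion hyj),
    sameVertex_congr (sameVertex_of_explosion (he.sameVertex_iff.2 hxi))
      (sameVertex_of_explosion (he.sameVertex_iff.2 hyj)), he.nthVertex, he.nthVertex]
  have := Setoid.ext_iff.1 hrel (⟨i, hi⟩ : Fin _) ⟨j, hj⟩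
  rw [explosionRel_iff, explosionRel_iff] at this
  exact this.symm

theorem isIso_of_isIso_explosion (h : M.IsTreeTour T α) (h' : N.IsTreeTour T' α')
    (hM : M.IsRootedMap) (hN : N.IsRootedMap)
    (he : (M.explosion (M.treeHeads T)).IsIso (N.explosion (N.treeHeads T')) e)
    (hheads : ∀ x, e x ∈ N.treeHeads T' ↔ x ∈ M.treeHeads T)
    (hvertex : ∀ x y, N.SameVertex (e x) (e y) ↔ M.SameVertex x y) : M.IsIso N e := by
  have hO := h.exists_iterate_mem_treeHeads
  have hO' := h'.exists_iterate_mem_treeHeads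
  have edge_inv (x : H) : M.edge⁻¹ x = M.edge x := by rw [inv_eq_iff_eq, h.edge_edge]
  have edge_inv' (x : H') : N.edge⁻¹ x = N.edge x := by rw [inv_eq_iff_eq, h'.edge_edge]
  have hedge (x : H) : e (M.edge x) = N.edge (e x) := he.edge x
  have hsame (x y : H) : (N.edge * N.headPerm (N.treeHeads T') * N.edge⁻¹).SameCycle (e x) (e y) ↔
      (M.edge * M.headPerm (M.treeHeads T) * M.edge⁻¹).SameCycle x y := by
    rw [sameCycle_conj, sameCycle_conj, edge_inv, edge_inv, edge_inv', edge_inv', ← hedge, ← hedge,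
      headPerm_sameCycle_iff hO, headPerm_sameCycle_iff hO', e.apply_eq_iff_eq, hheads, hheads,
      hvertex]
  have hconj := (h.isNonCrossingFactor_headPerm hM).conj_apply (h'.isNonCrossingFactor_headPerm hN)
    h.explosion_sameCycle h'.explosion_sameCycle
    (fun x => (he.rot _).trans (congrArg _ (hedge x))) hsame
  have headPerm (x : H) : e (M.headPerm (M.treeHeads T) x) =
      N.headPerm (N.treeHeads T') (e x) := by
    have := hconj (M.edge x)
    simp only [Equiv.Perm.mul_apply, edge_inv, edge_inv', hedge, h.edge_edge, h'.edge_edge] at this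
    exact N.edge.injective this
  refine ⟨fun x => ?_, hedge, he.root⟩
  rw [← explosion_rot_headPerm (O := M.treeHeads T), he.rot, headPerm, explosion_rot_headPerm]

theorem tour_mem_tree_iff (h : M.IsTreeTour T α) {k : ℕ} (hk : k < Nat.card H) :
    M.tour T k ∈ T ↔ M.tour T k = M.root ∨
      (M.tour T k ∈ M.treeHeads T ↔ ∃ j < k, M.tour T j = M.edge (M.tour T k)) := by
  have hvisited : M.tourTime α (M.edge (M.tour T k)) < k ↔
      ∃ j < k, M.tour T j = M.edge (M.tour T k) := by
    refine ⟨fun hlt => ⟨_, hlt, h.tour_tourTime _⟩, ?_⟩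
    rintro ⟨j, hj, hjk⟩
    rwa [← hjk, h.tourTime_tour (hj.trans hk)]
  rw [h.mem_tree_iff, h.tourTime_tour hk, hvisited]

theorem mem_tree_iff_of_isIso (h : M.IsTreeTour T α) (h' : N.IsTreeTour T' α')
    (he : M.IsIso N e) (hheads : ∀ x, e x ∈ N.treeHeads T' ↔ x ∈ M.treeHeads T) (x : H) :
    e x ∈ T' ↔ x ∈ T := by
  have hcard := Nat.card_congr e
  have mem_iff {k : ℕ} (hk : k < Nat.card H)
      (htour : ∀ j ≤ k, e (M.tour T j) = N.tour T' j) : N.tour T' k ∈ T' ↔ M.tour T k ∈ T := by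
    have hvisited : (∃ j < k, N.tour T' j = N.edge (N.tour T' k)) ↔
        ∃ j < k, M.tour T j = M.edge (M.tour T k) := by
      refine exists_congr fun j => and_congr_right fun hj => ?_
      rw [← htour j hj.le, ← htour k le_rfl, ← he.edge, e.apply_eq_iff_eq]
    rw [h.tour_mem_tree_iff hk, h'.tour_mem_tree_iff (hcard ▸ hk), hvisited, ← htour k le_rfl,
      hheads, ← he.root, e.apply_eq_iff_eq]
  have htour (k : ℕ) (hk : k < Nat.card H) : e (M.tour T k) = N.tour T' k := by
    induction k using Nat.strong_induction_on with
    | _ k ih =>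
    cases k with
    | zero => exact he.root
    | succ k =>
      have hprev (j : ℕ) (hj : j ≤ k) := ih j (by omega) (by omega)
      have hmem := mem_iff (by omega) hprev
      rw [← hprev k le_rfl] at hmem
      rw [tour_succ, tour_succ, ← hprev k le_rfl, tourStep, tourStep]
      by_cases hk : M.tour T k ∈ T
      · rw [if_pos hk, if_pos (hmem.2 hk), he.rot, he.edge]
      · rw [if_neg hk, if_neg (hk ∘ hmem.1), he.rot]
  have hx := h.tourTime_lt_card x
  rw [← h.tour_tourTime x, htour _ hx]
  exact mem_iff hx fun j hj => htour j (hj.trans_lt hx)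

theorem treeHeads_iff_of_isIso_explosion (h : M.IsTreeTour T α) (h' : N.IsTreeTour T' α')
    (he : (M.explosion (M.treeHeads T)).IsIso (N.explosion (N.treeHeads T')) e) (x : H) :
    e x ∈ N.treeHeads T' ↔ x ∈ M.treeHeads T := by
  rw [← h.treeHeads_explosion, ← h'.treeHeads_explosion]
  exact he.mem_treeHeads_iff (by simp) x

end IsTreeTour

end MapData

section Catalan

open Finset

theorem sum_antidiagonal_two_mul {R : Type*} [AddCommMonoid R] {F : ℕ → ℕ → R}
    (hF : ∀ i j, Odd i → F i j = 0) (n : ℕ) :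
    ∑ p ∈ antidiagonal (2 * n), F p.1 p.2 = ∑ p ∈ antidiagonal n, F (2 * p.1) (2 * p.2) := by
  symm
  refine sum_of_injOn (fun p => (2 * p.1, 2 * p.2)) (fun p _ q _ h => ?_) (fun p hp => ?_)
    (fun p hp hnot => hF _ _ (Nat.not_even_iff_odd.1 fun ⟨i, hi⟩ => hnot ?_)) fun _ _ => rfl
  · simp only [Prod.mk.injEq] at h
    ext <;> omega
  · simp only [mem_coe, HasAntidiagonal.mem_antidiagonal] at *
    omega
  · rw [HasAntidiagonal.mem_antidiagonal] at hp
    exact ⟨(i, n - i), by rw [mem_coe, HasAntidiagonal.mem_antidiagonal]; omega,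
      by ext <;> dsimp <;> omega⟩

/-- The Catalan numbers, at even indices, interspersed with zeros: the number of non-crossing
matchings of `k` points on a line. -/
def aeratedCatalan (k : ℕ) : ℕ := if Even k then catalan (k / 2) else 0

theorem aeratedCatalan_two_mul (n : ℕ) : aeratedCatalan (2 * n) = catalan n := by
  simp [aeratedCatalan]

theorem aeratedCatalan_of_odd {k : ℕ} (hk : Odd k) : aeratedCatalan k = 0 :=
  if_neg (Nat.not_even_iff_odd.2 hk)

theorem sum_antidiagonal_aeratedCatalan (m : ℕ) :
    ∑ p ∈ antidiagonal m, aeratedCatalan p.1 * aeratedCatalan p.2 = aeratedCatalan (m + 2) := by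
  rcases m.even_or_odd' with ⟨n, rfl | rfl⟩
  · rw [sum_antidiagonal_two_mul (F := fun i j => aeratedCatalan i * aeratedCatalan j)
      fun i j hi => by rw [aeratedCatalan_of_odd hi, zero_mul], ← Nat.mul_succ,
      aeratedCatalan_two_mul, catalan_succ']
    simp only [aeratedCatalan_two_mul]
  · rw [aeratedCatalan_of_odd (k := 2 * n + 1 + 2) ⟨n + 1, by ring⟩]
    refine sum_eq_zero fun p hp => ?_
    rcases p.1.even_or_odd with heven | hodd
    · have hodd : Odd p.2 := by
        rw [HasAntidiagonal.mem_antidiagonal] at hp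
        grind
      rw [aeratedCatalan_of_odd hodd, mul_zero]
    · rw [aeratedCatalan_of_odd hodd, zero_mul]

theorem catalan_mul_factorial (k : ℕ) :
    catalan k * ((k + 1).factorial * k.factorial) = (2 * k).factorial := by
  have hcentral := Nat.add_choose_mul_factorial_mul_factorial k k
  rw [← two_mul, ← Nat.centralBinom_eq_two_mul_choose, ← succ_mul_catalan_eq_centralBinom]
    at hcentral
  rw [← hcentral, Nat.factorial_succ]
  ring

theorem sum_choose_mul_choose (n : ℕ) :
    ∑ p ∈ antidiagonal n, n.choose p.1 * (n + 2).choose (p.2 + 1) =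
      (2 * (n + 1)).choose (n + 1) := by
  rw [show 2 * (n + 1) = n + (n + 2) by ring, Nat.add_choose_eq,
    Nat.sum_antidiagonal_succ' (f := fun p => n.choose p.1 * (n + 2).choose p.2)]
  simp

theorem choose_mul_catalan_mul_catalan (i j : ℕ) :
    (2 * (i + j)).choose (2 * i) * (catalan i * catalan j) *
        ((i + j).factorial * (i + j + 2).factorial) =
      (2 * (i + j)).factorial * ((i + j).choose i * (i + j + 2).choose (j + 1)) := by
  have hi := catalan_mul_factorial i
  have hj := catalan_mul_factorial j
  have hij := Nat.add_choose_mul_factorial_mul_factorial j i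
  have hdouble := Nat.add_choose_mul_factorial_mul_factorial (2 * j) (2 * i)
  have hsucc := Nat.add_choose_mul_factorial_mul_factorial (i + 1) (j + 1)
  rw [add_comm j i] at hij
  rw [← mul_add, add_comm j i, ← hi, ← hj] at hdouble
  rw [show i + 1 + (j + 1) = i + j + 2 by ring] at hsucc
  rw [← hdouble, ← hij, ← hsucc]
  ring

theorem sum_choose_mul_catalan_mul_catalan (n : ℕ) :
    ∑ p ∈ antidiagonal n, (2 * n).choose (2 * p.1) * (catalan p.1 * catalan p.2) =
      catalan n * catalan (n + 1) := by
  have hpos : 0 < n.factorial * (n + 2).factorial := by positivity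
  refine Nat.eq_of_mul_eq_mul_right hpos ?_
  have hterm : ∀ p ∈ antidiagonal n,
      (2 * n).choose (2 * p.1) * (catalan p.1 * catalan p.2) *
        (n.factorial * (n + 2).factorial) =
          (2 * n).factorial * (n.choose p.1 * (n + 2).choose (p.2 + 1)) := by
    rintro ⟨i, j⟩ hij
    obtain rfl := HasAntidiagonal.mem_antidiagonal.1 hij
    exact choose_mul_catalan_mul_catalan i j
  rw [sum_mul, sum_congr rfl hterm, ← mul_sum, sum_choose_mul_choose,
    ← Nat.centralBinom_eq_two_mul_choose, ← succ_mul_catalan_eq_centralBinom,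
    ← catalan_mul_factorial n, Nat.factorial_succ (n + 1)]
  ring

theorem sum_powerset_aeratedCatalan {H : Type*} [DecidableEq H] {U : Finset H} {n : ℕ}
    (hU : #U = 2 * n) :
    ∑ S ∈ U.powerset, aeratedCatalan #S * aeratedCatalan #(U \ S) =
      catalan n * catalan (n + 1) := by
  have hcompl : ∀ S ∈ U.powerset, aeratedCatalan #S * aeratedCatalan #(U \ S) =
      aeratedCatalan #S * aeratedCatalan (2 * n - #S) := fun S hS => by
    rw [card_sdiff_of_subset (mem_powerset.1 hS), hU]
  rw [sum_congr rfl hcompl,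
    sum_powerset_apply_card fun k => aeratedCatalan k * aeratedCatalan (2 * n - k), hU,
    ← Nat.sum_antidiagonal_eq_sum_range_succ (n := 2 * n) (f := fun i j =>
      (2 * n).choose i • (aeratedCatalan i * aeratedCatalan j)),
    sum_antidiagonal_two_mul (F := fun i j =>
      (2 * n).choose i • (aeratedCatalan i * aeratedCatalan j))
      fun i j hi => by rw [aeratedCatalan_of_odd hi, zero_mul, smul_zero]]
  simp only [aeratedCatalan_two_mul, smul_eq_mul, sum_choose_mul_catalan_mul_catalan]

theorem sum_card_filter_lt_gt {H R : Type*} [LinearOrder H] [AddCommMonoid R] {T : Finset H}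
    {m : ℕ} (hT : #T = m + 1) (F : ℕ → ℕ → R) :
    ∑ b ∈ T, F #{x ∈ T | x < b} #{x ∈ T | b < x} = ∑ p ∈ antidiagonal m, F p.1 p.2 := by
  have hmem (b) (hb : b ∈ T) : #{x ∈ T | x < b} + #{x ∈ T | b < x} = m := by
    have hnot : ({x ∈ T | ¬ x < b} : Finset H) = insert b {x ∈ T | b < x} := by
      ext x
      grind
    have := card_filter_add_card_filter_not (s := T) (· < b)
    rw [hnot, card_insert_of_notMem (by simp)] at this
    omega
  have hlt (b) (hb : b ∈ T) (b') (hbb' : b < b') : #{x ∈ T | x < b} < #{x ∈ T | x < b'} :=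
    card_lt_card (ssubset_iff_of_subset (fun x => by grind) |>.2 ⟨b, by grind⟩)
  have hinj : Set.InjOn (fun b => (#{x ∈ T | x < b}, #{x ∈ T | b < x})) T := fun b hb b' hb' h => by
    have hrank := congrArg Prod.fst h
    rcases lt_trichotomy b b' with hlt' | heq | hlt'
    exacts [absurd hrank (hlt b hb b' hlt').ne, heq, absurd hrank (hlt b' hb' b hlt').ne']
  have hmaps : ∀ b ∈ T, (#{x ∈ T | x < b}, #{x ∈ T | b < x}) ∈ antidiagonal m := fun b hb =>
    HasAntidiagonal.mem_antidiagonal.2 (hmem b hb)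
  exact sum_nbij _ hmaps hinj (surjOn_of_injOn_of_card_le _ hmaps hinj
    (by rw [Nat.card_antidiagonal, hT])) fun _ _ => rfl

end Catalan

section Matching

open Finset

variable {H : Type*} [LinearOrder H]

/-- `f` exchanges the ends of the arcs of a non-crossing perfect matching of the points of `S`, and
fixes the other points. -/
structure IsNonCrossingMatching (S : Finset H) (f : H → H) : Prop where
  involutive : Function.Involutive f
  apply_eq_self_iff : ∀ x, f x = x ↔ x ∉ S
  apply_lt_apply : ∀ x y, x < y → y < f x → f y < f x

/-- The matching that joins `a` to `b`, and follows `g` to the left of `b` and `h` to its right;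
here `a` stands for the least matched point. -/
def matchingCons (a b : H) (g h : H → H) (x : H) : H :=
  if x = a then b else if x = b then a else if x < b then g x else h x

namespace IsNonCrossingMatching

variable {S T : Finset H} {f g h : H → H} {a b : H}

theorem apply_eq_self (hf : IsNonCrossingMatching S f) {x : H} (hx : x ∉ S) : f x = x :=
  (hf.apply_eq_self_iff x).2 hx

theorem apply_mem_iff (hf : IsNonCrossingMatching S f) {x : H} : f x ∈ S ↔ x ∈ S := by
  rw [← not_iff_not, ← hf.apply_eq_self_iff, ← hf.apply_eq_self_iff, hf.involutive x, eq_comm]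

theorem map_prop (hf : IsNonCrossingMatching S f) {p : H → Prop} (hp : ∀ x ∈ S, p x) {x : H}
    (hx : p x) : p (f x) := by
  by_cases hxS : x ∈ S
  · exact hp _ (hf.apply_mem_iff.2 hxS)
  · rwa [hf.apply_eq_self hxS]

theorem lt_apply (hf : IsNonCrossingMatching S f) {x y : H} (hxy : x < y) (hyx : y < f x) :
    x < f y := by
  by_contra! hle
  rcases hle.lt_or_eq with hlt | heq
  · have := hf.apply_lt_apply (f y) x hlt (by rwa [hf.involutive y])
    rw [hf.involutive y] at this
    exact this.not_gt hyx
  · rw [← heq, hf.involutive y] at hyx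
    exact hyx.false

theorem restrict (hf : IsNonCrossingMatching S f) (hT : T ⊆ S) (hfT : ∀ x ∈ T, f x ∈ T) :
    IsNonCrossingMatching T fun x => if x ∈ T then f x else x := by
  refine ⟨fun x => ?_, fun x => ?_, fun x y => ?_⟩
  · have := hf.involutive x
    grind
  · have := hf.apply_eq_self_iff x
    grind
  · have := hf.apply_lt_apply x y
    grind

theorem cons (ha : ∀ x ∈ T, a < x) (hb : b ∈ T)
    (hg : IsNonCrossingMatching {x ∈ T | x < b} g) (hh : IsNonCrossingMatching {x ∈ T | b < x} h) :
    IsNonCrossingMatching (insert a T) (matchingCons a b g h) := by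
  unfold matchingCons
  have := ha b hb
  have g_fix (x) : g x = x ↔ ¬(x ∈ T ∧ x < b) := by simpa using hg.apply_eq_self_iff x
  have h_fix (x) : h x = x ↔ ¬(x ∈ T ∧ b < x) := by simpa using hh.apply_eq_self_iff x
  have g_lt (x) : x < b → g x < b := hg.map_prop (p := (· < b)) (by grind)
  have lt_h (x) : b < x → b < h x := hh.map_prop (p := (b < ·)) (by grind)
  refine ⟨fun x => ?_, fun x => ?_, fun x y hxy hyx => ?_⟩
  · have := hg.involutive x
    have := hh.involutive x
    have : x ≠ a → g x ≠ a := hg.map_prop (p := (· ≠ a)) (by grind)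
    specialize g_lt x
    specialize lt_h x
    clear g_fix h_fix
    grind
  · specialize g_fix x
    specialize h_fix x
    clear g_lt lt_h
    grind
  · have := hg.apply_lt_apply x y hxy
    have := hh.apply_lt_apply x y hxy
    have : x < a → x ∉ T := fun h => mt (ha x) h.asymm
    specialize g_fix x
    clear h_fix
    grind

theorem apply_mem_of_lt (hf : IsNonCrossingMatching (insert a T) f) (ha : ∀ x ∈ T, a < x) {x : H}
    (hx : x ∈ T) (hlt : x < f a) : f x ∈ T ∧ f x < f a := by
  have hmem := hf.apply_mem_iff (x := x)
  have := hf.lt_apply (ha x hx) hlt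
  have := hf.apply_lt_apply a x (ha x hx) hlt
  grind

theorem apply_mem_of_gt (hf : IsNonCrossingMatching (insert a T) f) (ha : ∀ x ∈ T, a < x) {x : H}
    (hx : x ∈ T) (hlt : f a < x) : f x ∈ T ∧ f a < f x := by
  have hmem := hf.apply_mem_iff (x := x)
  have hinv := hf.involutive x
  have hinv' := hf.involutive a
  have := hf.apply_lt_apply a (f x)
  grind

theorem exists_eq_matchingCons (hf : IsNonCrossingMatching (insert a T) f)
    (ha : ∀ x ∈ T, a < x) :
    ∃ b ∈ T, ∃ g h, IsNonCrossingMatching {x ∈ T | x < b} g ∧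
      IsNonCrossingMatching {x ∈ T | b < x} h ∧ matchingCons a b g h = f := by
  have : a ∉ T := fun h => (ha a h).false
  have hfa : f a ∈ T := by
    have := hf.apply_eq_self_iff a
    have := hf.apply_mem_iff (x := a)
    grind
  refine ⟨f a, hfa, _, _, hf.restrict (T := {x ∈ T | x < f a}) (by grind) fun x hx => ?_,
    hf.restrict (T := {x ∈ T | f a < x}) (by grind) fun x hx => ?_, funext fun x => ?_⟩
  · have := hf.apply_mem_of_lt ha (x := x)
    grind
  · have := hf.apply_mem_of_gt ha (x := x)
    grind
  · have := hf.apply_eq_self (x := x)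
    have := hf.involutive a
    grind [matchingCons]

theorem matchingCons_inj {b' : H} {g' h' : H → H} (ha : ∀ x ∈ T, a < x) (hb : b ∈ T)
    (hg : IsNonCrossingMatching {x ∈ T | x < b} g) (hh : IsNonCrossingMatching {x ∈ T | b < x} h)
    (hg' : IsNonCrossingMatching {x ∈ T | x < b'} g')
    (hh' : IsNonCrossingMatching {x ∈ T | b' < x} h')
    (heq : matchingCons a b g h = matchingCons a b' g' h') : b = b' ∧ g = g' ∧ h = h' := by
  have happly := congrFun heq
  simp only [matchingCons] at happly
  obtain rfl : b = b' := by simpa using happly a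
  have := ha b hb
  have : a ∉ T := fun h => (ha a h).false
  refine ⟨rfl, funext fun x => ?_, funext fun x => ?_⟩
  · have := happly x
    have := hg.apply_eq_self (x := x)
    have := hg'.apply_eq_self (x := x)
    grind
  · have := happly x
    have := hh.apply_eq_self (x := x)
    have := hh'.apply_eq_self (x := x)
    grind

theorem card_insert [Finite H] (ha : ∀ x ∈ T, a < x) :
    Nat.card {f // IsNonCrossingMatching (insert a T) f} =
      ∑ b ∈ T, Nat.card {g // IsNonCrossingMatching {x ∈ T | x < b} g} *
        Nat.card {h // IsNonCrossingMatching {x ∈ T | b < x} h} := by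
  let F (c : (b : T) × {g // IsNonCrossingMatching {x ∈ T | x < b.1} g} ×
      {h // IsNonCrossingMatching {x ∈ T | b.1 < x} h}) :
      {f // IsNonCrossingMatching (insert a T) f} := ⟨_, cons ha c.1.2 c.2.1.2 c.2.2.2⟩
  have injective : Function.Injective F := by
    rintro ⟨⟨b, hb⟩, ⟨g, hg⟩, h, hh⟩ ⟨⟨b', hb'⟩, ⟨g', hg'⟩, h', hh'⟩ heq
    obtain ⟨rfl, rfl, rfl⟩ := matchingCons_inj ha hb hg hh hg' hh' (congrArg Subtype.val heq)
    rfl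
  have surjective : Function.Surjective F := by
    rintro ⟨f, hf⟩
    obtain ⟨b, hb, g, h, hg, hh, rfl⟩ := hf.exists_eq_matchingCons ha
    exact ⟨⟨⟨b, hb⟩, ⟨g, hg⟩, h, hh⟩, rfl⟩
  rw [← Nat.card_congr (Equiv.ofBijective F ⟨injective, surjective⟩), Nat.card_sigma]
  simp only [Nat.card_prod]
  exact sum_coe_sort T fun b => Nat.card {g // IsNonCrossingMatching {x ∈ T | x < b} g} *
    Nat.card {h // IsNonCrossingMatching {x ∈ T | b < x} h}

theorem card_eq_aeratedCatalan [Finite H] (S : Finset H) :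
    Nat.card {f // IsNonCrossingMatching S f} = aeratedCatalan #S := by
  induction S using strongInduction with
  | _ S ih =>
  obtain rfl | hS := S.eq_empty_or_nonempty
  · have : Unique {f // IsNonCrossingMatching (∅ : Finset H) f} :=
      { default := ⟨id, fun _ => rfl, by simp, fun _ _ h h' => (h.trans h').false.elim⟩
        uniq := fun f => Subtype.ext (funext fun x => f.2.apply_eq_self (notMem_empty x)) }
    simp [aeratedCatalan]
  set a := S.min' hS
  have hS' : insert a (S.erase a) = S := insert_erase (S.min'_mem hS)
  have ha : ∀ x ∈ S.erase a, a < x := fun x hx => S.min'_lt_of_mem_erase_min' hS hx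
  have hssubset (p : H → Prop) [DecidablePred p] : {x ∈ S.erase a | p x} ⊂ S :=
    (filter_subset _ _).trans_ssubset (erase_ssubset (S.min'_mem hS))
  conv_lhs => rw [← hS', card_insert ha]
  simp only [ih _ (hssubset _)]
  have hcard : #(S.erase a) + 1 = #S := card_erase_add_one (S.min'_mem hS)
  rcases hm : #(S.erase a) with _ | m
  · rw [card_eq_zero.1 hm, sum_empty, aeratedCatalan_of_odd]
    exact ⟨0, by omega⟩
  · rw [sum_card_filter_lt_gt hm fun i j => aeratedCatalan i * aeratedCatalan j,
      sum_antidiagonal_aeratedCatalan]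
    congr 1
    omega

end IsNonCrossingMatching

end Matching

section Rotation

variable {m : ℕ}

theorem iterate_finRotate_zero (x : Fin (m + 1)) : (finRotate (m + 1))^[x] 0 = x := by
  induction x using Fin.induction with
  | zero => rfl
  | succ i ih =>
    rw [Fin.val_castSucc] at ih
    rw [Fin.val_succ, Function.iterate_succ_apply', ih, finRotate_apply, Fin.coeSucc_eq_succ]

theorem sameCycle_finRotate (x y : Fin (m + 1)) : (finRotate (m + 1)).SameCycle x y :=
  (sameCycle_iff_exists_iterate.2 ⟨x, iterate_finRotate_zero x⟩).symm.trans
    (sameCycle_iff_exists_iterate.2 ⟨y, iterate_finRotate_zero y⟩)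

theorem cyclicDist_finRotate_zero (x : Fin (m + 1)) : cyclicDist (finRotate (m + 1)) 0 x = x := by
  have := cyclicDist_iterate_of_lt sameCycle_finRotate (0 : Fin (m + 1)) (k := x)
    (by rw [Nat.card_fin]; exact x.2)
  rwa [iterate_finRotate_zero] at this

theorem IsNonCrossingMatching.isNonCrossingFactor {S : Finset (Fin (m + 1))}
    {f : Fin (m + 1) → Fin (m + 1)} (hf : IsNonCrossingMatching S f) :
    IsNonCrossingFactor (finRotate (m + 1)) hf.involutive.toPerm := by
  intro x y
  have arc (z : Fin (m + 1)) := cyclicDist_add sameCycle_finRotate 0 x z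
  have lt_card (z : Fin (m + 1)) := cyclicDist_lt_card sameCycle_finRotate 0 z
  simp only [cyclicDist_finRotate_zero, Function.Involutive.coe_toPerm] at arc lt_card ⊢
  rcases le_or_gt x (f x) with hx | hx
  · have between : x ≤ y → y ≤ f x → x ≤ f y ∧ f y ≤ f x := fun hxy hyx => by
      rcases hxy.eq_or_lt with rfl | hxy
      · exact ⟨hx, le_rfl⟩
      rcases hyx.eq_or_lt with rfl | hyx
      · rw [hf.involutive]
        exact ⟨le_rfl, hx⟩
      · exact ⟨(hf.lt_apply hxy hyx).le, (hf.apply_lt_apply x y hxy hyx).le⟩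
    have := arc y
    have := arc (f x)
    have := arc (f y)
    have := lt_card (f x)
    omega
  · have between : f x < f y → f y < x → f x < y ∧ y < x := fun hxy hyx => by
      have hlt := hf.lt_apply (x := f x) hxy (by rwa [hf.involutive])
      have hgt := hf.apply_lt_apply (f x) (f y) hxy (by rwa [hf.involutive])
      rw [hf.involutive] at hlt hgt
      rw [hf.involutive] at hgt
      exact ⟨hlt, hgt⟩
    have := arc y
    have := arc (f x)
    have := arc (f y)
    have := lt_card y
    have := lt_card (f y)
    omega

open Finset in
theorem IsNonCrossingMatching.two_mul_numCycles_finRotate_mul {S : Finset (Fin (m + 1))}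
    {f : Fin (m + 1) → Fin (m + 1)} (hf : IsNonCrossingMatching S f) :
    2 * numCycles (finRotate (m + 1) * hf.involutive.toPerm) = #S + 2 := by
  have hfixed : Nat.card {x // f x = x} + #S = m + 1 := by
    simp only [hf.apply_eq_self_iff]
    have := card_le_univ S
    rw [Nat.card_eq_fintype_card, Fintype.card_subtype_compl, Fintype.card_coe]
    rw [Fintype.card_fin] at *
    omega
  have hcycles := two_mul_numCycles (γ := hf.involutive.toPerm) hf.involutive
  rw [Function.Involutive.coe_toPerm] at hcycles
  have hgenus := (isNonCrossingFactor_iff sameCycle_finRotate).1 hf.isNonCrossingFactor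
  rw [Nat.card_fin] at hcycles hgenus
  omega

end Rotation

namespace MapData

variable {m : ℕ}

/-- The rooted map whose half-edges are numbered in the order of a tour, `f` exchanging the halves
of the edges that the tour follows, and `g` the halves of the edges that it crosses. -/
def shuffle (f g : Equiv.Perm (Fin (m + 1))) : MapData (Fin (m + 1)) where
  rot := finRotate (m + 1) * f
  edge := f * g
  root := 0

theorem shuffle_rot_mul {f : Fin (m + 1) → Fin (m + 1)} (hf : Function.Involutive f)
    (g : Equiv.Perm (Fin (m + 1))) :
    (shuffle hf.toPerm g).rot * hf.toPerm = finRotate (m + 1) := by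
  ext x
  simp [shuffle, hf x]

theorem shuffle_rot_mul_edge {f : Fin (m + 1) → Fin (m + 1)} (hf : Function.Involutive f)
    (g : Equiv.Perm (Fin (m + 1))) :
    (shuffle hf.toPerm g).rot * (shuffle hf.toPerm g).edge = finRotate (m + 1) * g := by
  rw [← shuffle_rot_mul hf g, mul_assoc]
  rfl

open Finset in
theorem isTreeTour_shuffle {S : Finset (Fin (m + 1))} {f g : Fin (m + 1) → Fin (m + 1)}
    (hS : S ⊆ univ.erase 0) (hf : IsNonCrossingMatching S f)
    (hg : IsNonCrossingMatching (univ.erase 0 \ S) g) :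
    (shuffle hf.involutive.toPerm hg.involutive.toPerm).IsTreeTour (insert 0 S)
      hf.involutive.toPerm := by
  have mem_f (x) := hf.apply_mem_iff (x := x)
  have mem_g (x) := hg.apply_mem_iff (x := x)
  have f_fix (x) := hf.apply_eq_self_iff x
  have g_fix (x) := hg.apply_eq_self_iff x
  have : (0 : Fin (m + 1)) ∉ S := fun h => by simpa using hS h
  simp only [mem_sdiff, mem_erase, mem_univ, and_true] at mem_g g_fix
  constructor
  · intro x
    have := hf.involutive x
    have := hg.involutive x
    simp only [shuffle, Equiv.Perm.mul_apply, Function.Involutive.coe_toPerm]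
    grind
  · intro x
    simp only [shuffle, Equiv.Perm.mul_apply, Function.Involutive.coe_toPerm]
    grind
  · exact Set.mem_insert _ _
  · intro x hx
    simp only [shuffle, Equiv.Perm.mul_apply, Function.Involutive.coe_toPerm]
    simp only [Set.mem_insert_iff, mem_coe] at hx
    grind
  · intro x hx
    simp only [Set.mem_insert_iff, mem_coe, not_or] at hx
    simpa using (f_fix x).2 hx.2
  · rw [shuffle_rot_mul]
    exact sameCycle_finRotate
  · rw [shuffle_rot_mul]
    exact hf.isNonCrossingFactor

end MapData

section PlaneTrees

open Finset

namespace MapData.IsTreeTour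

variable {H : Type*} [Finite H] {M : MapData H} {T : Set H} {α : Equiv.Perm H} {m : ℕ}

theorem tourTime_mul_apply (h : M.IsTreeTour T α) (x : H) :
    M.tourTime α ((M.rot * α) x) = (M.tourTime α x + 1) % Nat.card H := by
  rw [tourTime, ← cyclicDist_iterate h.sameCycle M.root, Function.iterate_succ_apply', tourTime,
    iterate_cyclicDist h.sameCycle]

theorem exists_tourTime_equiv (h : M.IsTreeTour T α) (hcard : Nat.card H = m + 1) :
    ∃ e : H ≃ Fin (m + 1), (∀ x, (e x : ℕ) = M.tourTime α x) ∧
      ∀ x, e ((M.rot * α) x) = finRotate (m + 1) (e x) := by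
  let e (x : H) : Fin (m + 1) := ⟨M.tourTime α x, hcard ▸ h.tourTime_lt_card x⟩
  have injective : Function.Injective e := fun x y hxy =>
    h.tourTime_injective (congrArg Fin.val hxy)
  refine ⟨Equiv.ofBijective e (injective.bijective_of_nat_card_le (by rw [hcard, Nat.card_fin])),
    fun _ => rfl, fun x => Fin.ext ?_⟩
  rw [finRotate_apply, Fin.val_add, Fin.val_one', Nat.add_mod_mod]
  have := h.tourTime_mul_apply x
  rwa [hcard] at this

end MapData.IsTreeTour

theorem MapData.IsPlaneTree.exists_isIso_shuffle {H : Type*} [Finite H] {M : MapData H} {m : ℕ}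
    (hM : M.IsPlaneTree) (hcard : Nat.card H = m + 1) :
    ∃ f : {f // IsNonCrossingMatching (univ.erase (0 : Fin (m + 1))) f}, ∃ e,
      M.IsIso (shuffle f.2.involutive.toPerm 1) e := by
  have h := isPlaneTree_iff_isTreeTour.1 hM
  obtain ⟨e, he, hrot⟩ := h.exists_tourTime_equiv hcard
  have hroot : e M.root = 0 := Fin.ext (by rw [he, h.tourTime_root, Fin.val_zero])
  have hf : IsNonCrossingMatching (univ.erase 0) fun i => e (M.edge (e.symm i)) := by
    refine ⟨fun i => by simp [h.edge_edge], fun i => ?_, fun i j => ?_⟩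
    · rw [← e.eq_symm_apply, h.edge_eq_self_iff, e.symm_apply_eq, hroot]
      simp
    · obtain ⟨x, rfl⟩ := e.surjective i
      obtain ⟨y, rfl⟩ := e.surjective j
      simp only [e.symm_apply_apply, Fin.lt_def, he]
      exact fun hxy hyx => (h.edge_between trivial trivial hxy hyx).2
  refine ⟨⟨_, hf⟩, e, fun x => ?_, fun x => ?_, hroot⟩
  · have := hrot (M.edge x)
    simp_all [shuffle, h.edge_edge]
  · simp [shuffle]

theorem exists_injective_planeTree (n : ℕ) :
    ∃ F : PlaneTree n → {f // IsNonCrossingMatching (univ.erase (0 : Fin (2 * n + 1))) f},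
      Function.Injective F := by
  choose F e he using fun q : PlaneTree n =>
    (Quotient.out q).2.exists_isIso_shuffle (Nat.card_fin (2 * n + 1))
  refine ⟨F, fun q q' hq => ?_⟩
  have he' := he q'
  rw [← hq] at he'
  exact Quotient.out_equiv_out.1 ⟨_, (he q).trans he'.symm⟩

theorem planeTree_finite (n : ℕ) : Finite (PlaneTree n) := by
  obtain ⟨F, hF⟩ := exists_injective_planeTree n
  exact Finite.of_injective F hF

theorem card_planeTree_le (n : ℕ) : Nat.card (PlaneTree n) ≤ catalan n := by
  obtain ⟨F, hF⟩ := exists_injective_planeTree n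
  calc Nat.card (PlaneTree n) ≤ _ := Nat.card_le_card_of_injective F hF
    _ = catalan n := by
      rw [IsNonCrossingMatching.card_eq_aeratedCatalan, card_erase_of_mem (mem_univ _), card_univ,
        Fintype.card_fin, Nat.add_sub_cancel, aeratedCatalan_two_mul]

end PlaneTrees

section TreeRootedMaps

open Finset

namespace MapData

theorem IsTreeTour.connected {H : Type*} [Finite H] {M : MapData H} {T : Set H}
    {α : Equiv.Perm H} (h : M.IsTreeTour T α) (x y : H) : M.Joined Set.univ x y := by
  refine (mem_iff_of_sameCycle (s := {y | M.Joined Set.univ x y}) (fun y hy => ?_)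
    (h.sameCycle x y)).1 (.refl x)
  rw [← h.tourStep_eq]
  exact hy.trans _ _ _ (M.joined_tourStep fun _ => trivial)

variable {m : ℕ} {S S' : Finset (Fin (m + 1))} {f f' g g' : Fin (m + 1) → Fin (m + 1)}

theorem isRootedMap_shuffle (hS : S ⊆ univ.erase 0) (hf : IsNonCrossingMatching S f)
    (hg : IsNonCrossingMatching (univ.erase 0 \ S) g) :
    (shuffle hf.involutive.toPerm hg.involutive.toPerm).IsRootedMap := by
  have h := isTreeTour_shuffle hS hf hg
  refine ⟨h.edge_edge, h.edge_eq_self_iff, h.connected, ?_⟩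
  have vertices : 2 * (shuffle hf.involutive.toPerm hg.involutive.toPerm).numVertices = #S + 2 :=
    hf.two_mul_numCycles_finRotate_mul
  have faces : 2 * (shuffle hf.involutive.toPerm hg.involutive.toPerm).numFaces =
      #(univ.erase 0 \ S) + 2 := by
    rw [← hg.two_mul_numCycles_finRotate_mul, ← shuffle_rot_mul_edge hf.involutive]
    rfl
  have edges := two_mul_numEdges_add_one h.edge_edge h.edge_eq_self_iff
  have hcard : #(univ.erase 0 \ S) + #S = m := by
    rw [card_sdiff_add_card_eq_card hS, card_erase_of_mem (mem_univ _), card_univ,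
      Fintype.card_fin, Nat.add_sub_cancel]
  rw [Nat.card_fin] at edges
  omega

theorem tour_shuffle (hS : S ⊆ univ.erase 0) (hf : IsNonCrossingMatching S f)
    (hg : IsNonCrossingMatching (univ.erase 0 \ S) g) (k : ℕ) :
    (shuffle hf.involutive.toPerm hg.involutive.toPerm).tour (insert 0 S) k =
      (finRotate (m + 1))^[k] 0 := by
  rw [(isTreeTour_shuffle hS hf hg).tour_eq_iterate, shuffle_rot_mul]
  rfl

theorem eq_of_isIso_shuffle (hS : S ⊆ univ.erase 0) (hf : IsNonCrossingMatching S f)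
    (hg : IsNonCrossingMatching (univ.erase 0 \ S) g) (hS' : S' ⊆ univ.erase 0)
    (hf' : IsNonCrossingMatching S' f') (hg' : IsNonCrossingMatching (univ.erase 0 \ S') g')
    {e : Fin (m + 1) ≃ Fin (m + 1)}
    (he : (shuffle hf.involutive.toPerm hg.involutive.toPerm).IsIso
      (shuffle hf'.involutive.toPerm hg'.involutive.toPerm) e)
    (htree : ∀ x, e x ∈ (insert 0 S' : Set (Fin (m + 1))) ↔ x ∈ (insert 0 S : Set (Fin (m + 1)))) :
    S = S' ∧ f = f' ∧ g = g' := by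
  have id (x) : e x = x := by
    have := he.tour htree x
    rwa [tour_shuffle hS hf hg, tour_shuffle hS' hf' hg', iterate_finRotate_zero] at this
  have hff : f = f' := funext fun x => by simpa [shuffle, id] using he.rot x
  subst hff
  refine ⟨?_, rfl, funext fun x => hf.involutive.injective ?_⟩
  · ext x
    rw [← not_iff_not, ← hf.apply_eq_self_iff, ← hf'.apply_eq_self_iff]
  · simpa [shuffle, id] using he.edge x

end MapData

/-- The pairs of non-crossing matchings whose arcs end at complementary sets of nonzero points. -/
def MatchingShuffle (m : ℕ) : Type :=
  (S : (univ.erase (0 : Fin (m + 1))).powerset) × {f // IsNonCrossingMatching S.1 f} ×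
    {g // IsNonCrossingMatching (univ.erase 0 \ S.1) g}

theorem card_matchingShuffle (n : ℕ) :
    Nat.card (MatchingShuffle (2 * n)) = catalan n * catalan (n + 1) := by
  have hcard : #(univ.erase (0 : Fin (2 * n + 1))) = 2 * n := by
    rw [card_erase_of_mem (mem_univ _), card_univ, Fintype.card_fin, Nat.add_sub_cancel]
  rw [MatchingShuffle, Nat.card_sigma]
  simp only [Nat.card_prod, IsNonCrossingMatching.card_eq_aeratedCatalan]
  rw [← sum_powerset_aeratedCatalan hcard]
  exact sum_coe_sort _ fun S => aeratedCatalan #S * aeratedCatalan #(univ.erase 0 \ S)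

/-- The map of a shuffle, with the first matching as its spanning tree. -/
def MatchingShuffle.treeRootedMap {n : ℕ} (c : MatchingShuffle (2 * n)) :
    LabelledTreeRootedMap n where
  map := .shuffle c.2.1.2.involutive.toPerm c.2.2.2.involutive.toPerm
  isRootedMap := MapData.isRootedMap_shuffle (mem_powerset.1 c.1.2) c.2.1.2 c.2.2.2
  tree := insert 0 c.1.1
  isSpanningTree :=
    (MapData.isTreeTour_shuffle (mem_powerset.1 c.1.2) c.2.1.2 c.2.2.2).isSpanningTree

theorem MatchingShuffle.treeRootedMap_injective (n : ℕ) : Function.Injective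
    fun c : MatchingShuffle (2 * n) => (Quotient.mk _ c.treeRootedMap : TreeRootedMap n) := by
  rintro ⟨⟨S, hS⟩, ⟨f, hf⟩, g, hg⟩ ⟨⟨S', hS'⟩, ⟨f', hf'⟩, g', hg'⟩ heq
  obtain ⟨e, he, htree⟩ := Quotient.exact heq
  obtain ⟨rfl, rfl, rfl⟩ := MapData.eq_of_isIso_shuffle (mem_powerset.1 hS) hf hg
    (mem_powerset.1 hS') hf' hg' he htree
  rfl

theorem catalan_mul_catalan_le_card (n : ℕ) [Finite (TreeRootedMap n)] :
    catalan n * catalan (n + 1) ≤ Nat.card (TreeRootedMap n) := by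
  rw [← card_matchingShuffle]
  exact Nat.card_le_card_of_injective _ (MatchingShuffle.treeRootedMap_injective n)

end TreeRootedMaps

section NonCrossingPartitions

open Finset

namespace IsNonCrossing

variable {L : Type*} [LinearOrder L] {r s : Setoid L} {a j : L}

theorem comap {L' : Type*} [LinearOrder L'] {f : L' → L} (hf : StrictMono f)
    (hr : IsNonCrossing r) : IsNonCrossing (r.comap f) :=
  fun _ _ _ _ hab hbc hcd => hr _ _ _ _ (hf hab) (hf hbc) (hf hcd)

theorem not_rel_of_lt_of_gt (hr : IsNonCrossing r) (ha : ∀ x, a ≤ x)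
    (hj : IsGreatest {x | r a x} j) {x y : L} (hx : x < j) (hy : j < y) : ¬ r x y := by
  intro hxy
  have hax : r a x := by
    rcases (ha x).eq_or_lt with rfl | hlt
    · exact r.refl _
    · exact hr a x j y hlt hx hy hj.1 hxy
  exact (hj.2 (r.trans hax hxy)).not_gt hy

theorem le_of_isGreatest (hr : IsNonCrossing r) (ha : ∀ x, a ≤ x)
    (hj : IsGreatest {x | r a x} j) (haj : s a j) (hlt : ∀ x < j, ∀ y < j, r x y → s x y)
    (hgt : ∀ x > j, ∀ y > j, r x y → s x y) : r ≤ s := by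
  have rel_of_lt {x y : L} (hlt' : x < y) (hxy : r x y) : s x y := by
    rcases lt_trichotomy y j with hy | rfl | hy
    · exact hlt x (hlt'.trans hy) y hy hxy
    · have hax := hlt a ((ha x).trans_lt hlt') x hlt' (r.trans hj.1 (r.symm hxy))
      exact s.trans (s.symm hax) haj
    · rcases lt_trichotomy x j with hx | rfl | hx
      · exact (hr.not_rel_of_lt_of_gt ha hj hx hy hxy).elim
      · exact ((hj.2 (r.trans hj.1 hxy)).not_gt hy).elim
      · exact hgt x hx y hy hxy
  intro x y hxy
  rcases lt_trichotomy x y with hlt' | rfl | hgt'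
  · exact rel_of_lt hlt' hxy
  · exact s.refl _
  · exact s.symm (rel_of_lt hgt' (r.symm hxy))

theorem eq_of_isGreatest (hr : IsNonCrossing r) (hs : IsNonCrossing s) (ha : ∀ x, a ≤ x)
    (hrj : IsGreatest {x | r a x} j) (hsj : IsGreatest {x | s a x} j)
    (hlt : r.comap ((↑) : {x // x < j} → L) = s.comap (↑))
    (hgt : r.comap ((↑) : {x // j < x} → L) = s.comap (↑)) : r = s := by
  have hlt (x) (hx : x < j) (y) (hy : y < j) : r x y ↔ s x y :=
    Setoid.ext_iff.1 hlt (⟨x, hx⟩ : {x // x < j}) ⟨y, hy⟩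
  have hgt (x) (hx : j < x) (y) (hy : j < y) : r x y ↔ s x y :=
    Setoid.ext_iff.1 hgt (⟨x, hx⟩ : {x // j < x}) ⟨y, hy⟩
  exact (hr.le_of_isGreatest ha hrj hsj.1 (fun x hx y hy => (hlt x hx y hy).1)
      fun x hx y hy => (hgt x hx y hy).1).antisymm
    (hs.le_of_isGreatest ha hsj hrj.1 (fun x hx y hy => (hlt x hx y hy).2)
      fun x hx y hy => (hgt x hx y hy).2)

end IsNonCrossing

theorem finite_isNonCrossing (L : Type*) [Finite L] [LinearOrder L] :
    Finite {r : Setoid L // IsNonCrossing r} :=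
  Finite.of_injective (fun r x y => r.1 x y) fun _ _ h =>
    Subtype.ext (Setoid.ext fun x y => iff_of_eq (congrFun₂ h x y))

/-- A non-crossing relation is determined by the greatest element equivalent to the least one, and
by its restrictions to both sides of that element. -/
theorem card_isNonCrossing_le_sum (L : Type*) [Fintype L] [Nonempty L] [LinearOrder L] :
    Nat.card {r : Setoid L // IsNonCrossing r} ≤
      ∑ j : L, Nat.card {r : Setoid {x // x < j} // IsNonCrossing r} *
        Nat.card {r : Setoid {x // j < x} // IsNonCrossing r} := by
  obtain ⟨a, ha⟩ := Finite.exists_min (id : L → L)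
  have (j : L) := finite_isNonCrossing {x // x < j}
  have (j : L) := finite_isNonCrossing {x // j < x}
  have exists_isGreatest (r : {r : Setoid L // IsNonCrossing r}) :
      ∃ j, IsGreatest {x | r.1 a x} j := by
    obtain ⟨j, hj, hmax⟩ := Set.exists_max_image {x | r.1 a x} id (Set.toFinite _) ⟨a, r.1.refl a⟩
    exact ⟨j, hj, hmax⟩
  choose j hj using exists_isGreatest
  let split (r : {r : Setoid L // IsNonCrossing r}) (j : L) :
      (j : L) × {r : Setoid {x // x < j} // IsNonCrossing r} ×
        {r : Setoid {x // j < x} // IsNonCrossing r} :=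
    ⟨j, ⟨_, r.2.comap (Subtype.strictMono_coe _)⟩, ⟨_, r.2.comap (Subtype.strictMono_coe _)⟩⟩
  have eq_of_split_eq {r s i j} (hr : IsGreatest {x | r.1 a x} i)
      (hs : IsGreatest {x | s.1 a x} j) (h : split r i = split s j) : r = s := by
    obtain rfl : i = j := congrArg Sigma.fst h
    simp only [split, Sigma.mk.injEq, heq_eq_eq, true_and, Prod.mk.injEq, Subtype.mk.injEq] at h
    exact Subtype.ext (r.2.eq_of_isGreatest s.2 ha hr hs h.1 h.2)
  refine (Nat.card_le_card_of_injective (fun r => split r (j r))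
    fun r s => eq_of_split_eq (hj r) (hj s)).trans_eq ?_
  simp only [Nat.card_sigma, Nat.card_prod]

theorem card_isNonCrossing_le_catalan (L : Type*) [Finite L] [LinearOrder L] :
    Nat.card {r : Setoid L // IsNonCrossing r} ≤ catalan (Nat.card L) := by
  induction hm : Nat.card L using Nat.strong_induction_on generalizing L with
  | _ m ih =>
  have := Fintype.ofFinite L
  rcases m with _ | m
  · have : IsEmpty L := (Nat.card_eq_zero.1 hm).resolve_right fun h => h.not_finite ‹_›
    have : Subsingleton {r : Setoid L // IsNonCrossing r} :=
      ⟨fun r s => Subtype.ext (Setoid.ext isEmptyElim)⟩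
    rw [catalan_zero]
    exact Finite.card_le_one_iff_subsingleton.2 this
  have : Nonempty L := (Nat.card_pos_iff.1 (hm ▸ m.succ_pos)).1
  have hcard : #(univ : Finset L) = m + 1 := by rw [card_univ, ← Nat.card_eq_fintype_card, hm]
  have card_subtype (p : L → Prop) [DecidablePred p] : Nat.card {x // p x} = #{x | p x} := by
    rw [Nat.card_eq_fintype_card, Fintype.card_subtype]
  have lt_card (j : L) (p : L → Prop) [DecidablePred p] (hj : ¬ p j) : #{x | p x} < m + 1 :=
    hcard ▸ card_lt_card (filter_ssubset.2 ⟨j, mem_univ j, hj⟩)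
  refine (card_isNonCrossing_le_sum L).trans ?_
  calc _ ≤ ∑ j : L, catalan #{x | x < j} * catalan #{x | j < x} :=
        sum_le_sum fun j _ => Nat.mul_le_mul
          (ih _ (lt_card j (· < j) (lt_irrefl j)) _ (card_subtype _))
          (ih _ (lt_card j (j < ·) (lt_irrefl j)) _ (card_subtype _))
    _ = catalan (m + 1) := by
        rw [sum_card_filter_lt_gt hcard fun i j => catalan i * catalan j, catalan_succ']

end NonCrossingPartitions

namespace LabelledTreeRootedMap

variable {n : ℕ} (M N : LabelledTreeRootedMap n)

theorem exists_isTreeTour : ∃ α, M.map.IsTreeTour M.tree α :=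
  M.isSpanningTree.exists_isTreeTour M.isRootedMap

theorem numVertices_phi0 : M.phi0.numVertices = n + 1 := by
  obtain ⟨α, h⟩ := M.exists_isTreeTour
  have := h.two_mul_ncard_treeHeads
  rw [phi0, MapData.numVertices_explosion h.exists_iterate_mem_treeHeads]
  rw [Nat.card_fin] at this
  omega

theorem isPlaneTree_phi0 : M.phi0.IsPlaneTree := by
  obtain ⟨α, h⟩ := M.exists_isTreeTour
  exact h.isPlaneTree_explosion

theorem isNonCrossing_phi1 : IsNonCrossing M.phi1 := by
  obtain ⟨α, h⟩ := M.exists_isTreeTour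
  exact h.isNonCrossing_explosionRel M.isRootedMap M.numVertices_phi0.ge

/-- The plane tree and the non-crossing partition produced from a tree-rooted map. -/
noncomputable def phi : PlaneTree n × NonCrossingPartition (n + 1) :=
  (Quotient.mk (LabelledPlaneTree.setoid n) ⟨M.phi0, M.isPlaneTree_phi0⟩,
    ⟨M.phi1, M.isNonCrossing_phi1⟩)

variable {M N}

theorem phi_eq_phi_iff : M.phi = N.phi ↔ M ≈ N := by
  constructor
  · intro hMN
    obtain ⟨α, h⟩ := M.exists_isTreeTour
    obtain ⟨β, h'⟩ := N.exists_isTreeTour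
    obtain ⟨e, he⟩ : ∃ e, M.phi0.IsIso N.phi0 e := Quotient.exact (congrArg Prod.fst hMN)
    have hrel : M.map.explosionRel (M.map.treeHeads M.tree) M.phi0.numVertices =
        N.map.explosionRel (N.map.treeHeads N.tree) M.phi0.numVertices := by
      rw [M.numVertices_phi0]
      exact congrArg Subtype.val (congrArg Prod.snd hMN)
    have hheads := h.treeHeads_iff_of_isIso_explosion h' he
    have hiso := h.isIso_of_isIso_explosion h' M.isRootedMap N.isRootedMap he hheads
      (h.sameVertex_iff_of_explosionRel_eq he hrel)
    exact ⟨e, hiso, h.mem_tree_iff_of_isIso h' hiso hheads⟩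
  · rintro ⟨e, he, htree⟩
    have hheads := he.mem_treeHeads_iff htree
    exact Prod.ext (Quotient.sound ⟨e, he.explosion hheads⟩)
      (Subtype.ext (he.explosionRel_eq hheads (n + 1)).symm)

end LabelledTreeRootedMap

theorem mainTheorem1 (n : ℕ) :
    (∃ Φ : TreeRootedMap n → PlaneTree n × NonCrossingPartition (n + 1),
      (∀ M : LabelledTreeRootedMap n,
        ∃ (h₀ : M.phi0.IsPlaneTree) (h₁ : IsNonCrossing M.phi1),
          Φ (Quotient.mk (LabelledTreeRootedMap.setoid n) M) =
            (Quotient.mk (LabelledPlaneTree.setoid n) ⟨M.phi0, h₀⟩, ⟨M.phi1, h₁⟩)) ∧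
      Function.Bijective Φ) ∧
    Nat.card (TreeRootedMap n) = catalan n * catalan (n + 1) := by
  have : Finite (PlaneTree n) := planeTree_finite n
  have : Finite (NonCrossingPartition (n + 1)) := finite_isNonCrossing (Fin (n + 1))
  let Φ : TreeRootedMap n → PlaneTree n × NonCrossingPartition (n + 1) :=
    Quotient.lift LabelledTreeRootedMap.phi fun _ _ => LabelledTreeRootedMap.phi_eq_phi_iff.2
  have injective : Function.Injective Φ := fun x y => Quotient.inductionOn₂ x y fun _ _ h =>
    Quotient.sound (LabelledTreeRootedMap.phi_eq_phi_iff.1 h)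
  have : Finite (TreeRootedMap n) := Finite.of_injective Φ injective
  have hle : Nat.card (PlaneTree n × NonCrossingPartition (n + 1)) ≤
      catalan n * catalan (n + 1) := by
    have := card_isNonCrossing_le_catalan (Fin (n + 1))
    rw [Nat.card_fin] at this
    rw [Nat.card_prod]
    exact Nat.mul_le_mul (card_planeTree_le n) this
  have hge := catalan_mul_catalan_le_card n
  exact ⟨⟨Φ, fun M => ⟨M.isPlaneTree_phi0, M.isNonCrossing_phi1, rfl⟩,
      injective.bijective_of_nat_card_le (hle.trans hge)⟩,
    ((Nat.card_le_card_of_injective Φ injective).trans hle).antisymm hge⟩
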